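/- Let $\mathbb{K}$ be an algebraically closed field, let $G$ be a connected semisimple linear algebraic group over $\mathbb{K}$, let $T$ be a maximal torus of $G$ with character lattice $M$, let $\Phi\subset M$ be the root system of $G$ with respect to $T$, and let $W=N_G(T)/T$ be the Weyl group. An element $w\in W$ with representative $n_w\in N_G(T)$ defines the automorphism $\varphi_w\colon T\to T$, $\varphi_w(t)=n_wtn_w^{-1}$; let $\tau(w)$ be the number of fixed points of $\varphi_w$ in $T$. Fix simple roots $\alpha_1,\dots,\alpha_r$ of $\Phi$, let $s_1,\dots,s_r\in W$ be the corresponding simple reflections, and let $\mathcal{C}=(\langle\alpha_i,\alpha_j^\vee\rangle)_{i,j}$ be the Cartan matrix. Let $w\in W$ be a Coxeter element, that is, a product of $s_1,\dots,s_r$, each taken once, in some order. Then $\tau(w)$ is finite, $\det(\mathcal{C})>0$, and (1) if $\mathbb{K}$ has characteristic zero, then $\tau(w)=\det(\mathcal{C})$; (2) if $\mathbb{K}$ has characteristic $p>0$, then $\tau(w)$ is equal to the $p'$-part of $\det(\mathcal{C})$, i.e. to $\det(\mathcal{C})$ divided by the greatest power of $p$ dividing it. -/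

import Mathlib

open Matrix

namespace AlgGrp

variable {K : Type*} [Field K] {n : ℕ}

/-! ### Linear algebraic groups -/

/-- The Zariski topology on `GL n K`: the sets where a polynomial in the matrix entries does not
vanish are open, and they generate the topology. -/
@[reducible] def zariski (n : ℕ) (K : Type*) [Field K] : TopologicalSpace (GL (Fin n) K) :=
  TopologicalSpace.generateFrom
    (Set.range fun p : MvPolynomial (Fin n × Fin n) K =>
      {g : GL (Fin n) K | MvPolynomial.eval (fun ij => (g : Matrix (Fin n) (Fin n) K) ij.1 ij.2) p ≠ 0})

/-- `H` is a (Zariski) closed subgroup of `GL n K`, i.e. a linear algebraic group. -/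
def IsAlgebraic (H : Subgroup (GL (Fin n) K)) : Prop :=
  @IsClosed _ (zariski n K) (H : Set (GL (Fin n) K))

/-- `H` is connected in the Zariski topology. -/
def IsConn (H : Subgroup (GL (Fin n) K)) : Prop :=
  @IsConnected _ (zariski n K) (H : Set (GL (Fin n) K))

/-- `G` is a connected semisimple linear algebraic group: it is closed and connected, and its only
closed connected solvable normal subgroup is the trivial one. -/
structure IsConnectedSemisimple (G : Subgroup (GL (Fin n) K)) : Prop where
  algebraic : IsAlgebraic G
  connected : IsConn G
  radical_trivial : ∀ H : Subgroup (GL (Fin n) K), H ≤ G → IsAlgebraic H → IsConn H →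
    (H.subgroupOf G).Normal → Group.IsSolvable H → H = ⊥

/-- The algebra of regular functions on a linear algebraic group `H ≤ GL n K`: it is generated by
the matrix entries of `g` and of `g⁻¹`. -/
def coordRing (H : Subgroup (GL (Fin n) K)) : Subalgebra K (H → K) :=
  Algebra.adjoin K
    ((Set.range fun ij : Fin n × Fin n => fun g : H =>
        ((g : GL (Fin n) K) : Matrix (Fin n) (Fin n) K) ij.1 ij.2) ∪
     (Set.range fun ij : Fin n × Fin n => fun g : H =>
        (((g : GL (Fin n) K)⁻¹ : GL (Fin n) K) : Matrix (Fin n) (Fin n) K) ij.1 ij.2))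

/-- The algebra of regular functions (Laurent polynomials) on the standard torus `(Kˣ)^r`. -/
def torusRing (r : ℕ) (K : Type*) [Field K] : Subalgebra K ((Fin r → Kˣ) → K) :=
  Algebra.adjoin K
    ((Set.range fun i : Fin r => fun x : Fin r → Kˣ => (x i : K)) ∪
     (Set.range fun i : Fin r => fun x : Fin r → Kˣ => ((x i)⁻¹ : K)))

/-- A map between sets with given algebras of regular functions is regular if it pulls regular
functions back to regular functions. -/
def IsRegularMap {X Y : Type*} (A : Subalgebra K (X → K)) (B : Subalgebra K (Y → K))
    (f : X → Y) : Prop :=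
  ∀ b ∈ B, b ∘ f ∈ A

/-! ### Tori and characters -/

/-- `T` is a torus: a closed subgroup isomorphic, as an algebraic group, to some `(Kˣ)^r`. -/
def IsTorus (T : Subgroup (GL (Fin n) K)) : Prop :=
  IsAlgebraic T ∧ ∃ (r : ℕ) (e : T ≃* (Fin r → Kˣ)),
    IsRegularMap (coordRing T) (torusRing r K) e ∧
    IsRegularMap (torusRing r K) (coordRing T) e.symm

/-- `T` is a maximal torus of `G`. -/
structure IsMaximalTorus (T G : Subgroup (GL (Fin n) K)) : Prop where
  le : T ≤ G
  torus : IsTorus T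
  maximal : ∀ S : Subgroup (GL (Fin n) K), IsTorus S → T ≤ S → S ≤ G → S = T

theorem IsTorus.mul_comm {T : Subgroup (GL (Fin n) K)} (hT : IsTorus T) (a b : T) :
    a * b = b * a := by
  obtain ⟨_, r, e, _, _⟩ := hT
  apply e.injective
  rw [map_mul, map_mul, _root_.mul_comm]

theorem inv_mem_coordRing {H : Subgroup (GL (Fin n) K)} {f : H → K} (hf : f ∈ coordRing H) :
    (fun g => f g⁻¹) ∈ coordRing H := by
  induction hf using Algebra.adjoin_induction with
  | mem f hf =>
    apply Algebra.subset_adjoin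
    rcases hf with ⟨ij, rfl⟩ | ⟨ij, rfl⟩
    · exact Or.inr ⟨ij, by funext g; simp⟩
    · exact Or.inl ⟨ij, by funext g; simp⟩
  | algebraMap r => exact (coordRing H).algebraMap_mem r
  | add f g _ _ hf hg => exact (coordRing H).add_mem hf hg
  | mul f g _ _ hf hg => exact (coordRing H).mul_mem hf hg

/-- The group of characters of `T`: homomorphisms `T → Kˣ` that are regular functions. -/
def charGroup (T : Subgroup (GL (Fin n) K)) : Subgroup (T →* Kˣ) where
  carrier := {χ | (fun t => (χ t : K)) ∈ coordRing T}
  mul_mem' {χ ψ} hχ hψ := by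
    have h := (coordRing T).mul_mem hχ hψ
    exact h
  one_mem' := (coordRing T).one_mem
  inv_mem' {χ} hχ := by
    have h := inv_mem_coordRing hχ
    simpa using h

/-- The character lattice of `T`, written additively. -/
abbrev CharLattice (T : Subgroup (GL (Fin n) K)) : Type _ := Additive (charGroup T)

/-- The value `χ(t)` of a character. -/
def charEval {T : Subgroup (GL (Fin n) K)} (χ : CharLattice T) (t : T) : Kˣ :=
  (Additive.toMul χ : charGroup T).1 t

/-! ### Lie algebra and roots -/

/-- The Lie algebra of `G ≤ GL n K`, as the tangent space at the identity inside the matrices: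
all `X` that are killed by the differentials at `1` of the polynomials vanishing on `G`. -/
def lieAlg (G : Subgroup (GL (Fin n) K)) : Submodule K (Matrix (Fin n) (Fin n) K) where
  carrier := {X | ∀ p : MvPolynomial (Fin n × Fin n) K,
    (∀ g ∈ G, MvPolynomial.eval
      (fun ij => (g : Matrix (Fin n) (Fin n) K) ij.1 ij.2) p = 0) →
    ∑ ij : Fin n × Fin n,
      MvPolynomial.eval (fun kl => (1 : Matrix (Fin n) (Fin n) K) kl.1 kl.2)
        (MvPolynomial.pderiv ij p) * X ij.1 ij.2 = 0}
  add_mem' {X Y} hX hY p hp := by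
    simp [mul_add, Finset.sum_add_distrib, hX p hp, hY p hp]
  zero_mem' p _ := by simp
  smul_mem' c X hX p hp := by
    have h := hX p hp
    simp only [Matrix.smul_apply, smul_eq_mul, mul_left_comm _ c, ← Finset.mul_sum, h, mul_zero]

/-- The roots of `G` with respect to `T`: the nonzero weights of the adjoint action
`X ↦ t X t⁻¹` of `T` on the Lie algebra of `G`. -/
def roots (G T : Subgroup (GL (Fin n) K)) : Set (CharLattice T) :=
  {α | α ≠ 0 ∧ ∃ X ∈ lieAlg G, X ≠ 0 ∧ ∀ t : T,
    ((t : GL (Fin n) K) : Matrix (Fin n) (Fin n) K) * X *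
      (((t : GL (Fin n) K)⁻¹ : GL (Fin n) K) : Matrix (Fin n) (Fin n) K) =
    (charEval α t : K) • X}

section RootSystem

variable {M : Type*} [AddCommGroup M]

/-- `α` is a base (system of simple roots) of `Φ`: its members are linearly independent elements of
`Φ`, and each element of `Φ` is a combination of them with coefficients that are all nonnegative
or all nonpositive integers. -/
structure IsBase {ι : Type*} (Φ : Set M) (α : ι → M) : Prop where
  mem : ∀ i, α i ∈ Φ
  linearIndependent : LinearIndependent ℤ α
  mem_or_neg_mem : ∀ β ∈ Φ, β ∈ AddSubmonoid.closure (Set.range α) ∨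
    -β ∈ AddSubmonoid.closure (Set.range α)

/-- `f` is the coroot `α^∨` of `α`: `f α = 2`, and the reflection `x ↦ x - f x • α` preserves `Φ`.
There is at most one such `f` when `Φ` is finite and spans a subgroup of finite index in a
lattice. -/
def IsCoroot (Φ : Set M) (α : M) (f : Module.Dual ℤ M) : Prop :=
  f α = 2 ∧ Set.MapsTo (Module.preReflection α f) Φ Φ

open Classical in
/-- The coroot of `α`. -/
noncomputable def coroot (Φ : Set M) (α : M) : Module.Dual ℤ M :=
  if h : ∃ f, IsCoroot Φ α f then h.choose else 0

/-- The Cartan matrix `⟨α i, (α j)^∨⟩`. -/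
noncomputable def cartanMatrix {ι : Type*} (Φ : Set M) (α : ι → M) : Matrix ι ι ℤ :=
  Matrix.of fun i j => coroot Φ (α j) (α i)

end RootSystem

/-! ### The Weyl group -/

/-- The normalizer of `T` in `G`. -/
def normalizerIn (G T : Subgroup (GL (Fin n) K)) : Subgroup (GL (Fin n) K) :=
  G ⊓ Subgroup.normalizer (T : Set (GL (Fin n) K))

instance (G T : Subgroup (GL (Fin n) K)) : (T.subgroupOf (normalizerIn G T)).Normal :=
  Subgroup.normal_subgroupOf_of_le_normalizer inf_le_right

/-- The Weyl group `N_G(T) / T`. -/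
abbrev WeylGroup (G T : Subgroup (GL (Fin n) K)) : Type _ :=
  normalizerIn G T ⧸ T.subgroupOf (normalizerIn G T)

/-- The action of the Weyl group on the torus: the class of `x ∈ N_G(T)` acts by
`t ↦ x t x⁻¹`. -/
def weylAut (G : Subgroup (GL (Fin n) K)) {T : Subgroup (GL (Fin n) K)} (hT : IsTorus T) :
    WeylGroup G T →* MulAut T :=
  QuotientGroup.lift (T.subgroupOf (normalizerIn G T))
    (T.normalizerMonoidHom.comp (Subgroup.inclusion inf_le_right)) (by
      intro x hx
      ext1 t
      apply Subtype.ext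
      have h := congrArg Subtype.val (hT.mul_comm ⟨(x : GL (Fin n) K), hx⟩ t)
      have h' : (x : GL (Fin n) K) * (t : GL (Fin n) K) = t * x := h
      change (x : GL (Fin n) K) * (t : GL (Fin n) K) * (x : GL (Fin n) K)⁻¹ = t
      rw [h', mul_inv_cancel_right])

/-- The set of fixed points in `T` of the automorphism defined by `w`. -/
def fixedPts (G : Subgroup (GL (Fin n) K)) {T : Subgroup (GL (Fin n) K)} (hT : IsTorus T)
    (w : WeylGroup G T) : Set T :=
  {t | weylAut G hT w t = t}

/-- `s` is the reflection in the root `α`: in its action `χ ↦ χ ∘ s⁻¹` on the characters of `T`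
it sends `χ` to `χ - ⟨χ, α^∨⟩ α`. -/
def IsReflectionIn (G : Subgroup (GL (Fin n) K)) {T : Subgroup (GL (Fin n) K)} (hT : IsTorus T)
    (α : CharLattice T) (s : WeylGroup G T) : Prop :=
  ∃ f : Module.Dual ℤ (CharLattice T), IsCoroot (roots G T) α f ∧
    ∀ (χ : CharLattice T) (t : T),
      charEval χ ((weylAut G hT s)⁻¹ t) = charEval (Module.preReflection α f χ) t

/-- `w` is a Coxeter element with respect to the simple roots `α i`: a product of the simple
reflections, each taken once, in some order. -/
def IsCoxeterElement {ι : Type*} (G : Subgroup (GL (Fin n) K)) {T : Subgroup (GL (Fin n) K)}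
    (hT : IsTorus T) (α : ι → CharLattice T) (w : WeylGroup G T) : Prop :=
  ∃ s : ι → WeylGroup G T, (∀ i, IsReflectionIn G hT (α i) (s i)) ∧
    ∃ l : List ι, l.Nodup ∧ (∀ i, i ∈ l) ∧ w = (l.map s).prod

end AlgGrp

/-!
A point `t` of `T` is fixed by `w` if and only if every character `χ - w χ` takes the value `1` at
`t`. Since the torus `T` is the group of homomorphisms from its character lattice `M` to `Kˣ`, the
fixed points are the homomorphisms that kill the image of `1 - w` on `M`. If `det (1 - w) ≠ 0`, the
Smith normal form of `1 - w` turns these into families of roots of unity, and their number is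
`|det (1 - w)|`, or its `p'`-part in characteristic `p` (`card_homs_killing_range_of_charZero`,
`card_homs_killing_range_of_charP`).

For a product `w` of the reflections `x ↦ x - f i x • α i`, each taken once, telescoping gives a
factorization of `1 - w` through the maps `x ↦ (f i x)_i` and `c ↦ ∑ c i • α i` with a unimodular
matrix in between. If there are as many `α i` as the rank of `M`, it follows that `det (1 - w)` is
the determinant of the Cartan matrix (`det_one_sub_prod_preReflection`). This determinant is
nonnegative because `w` has finite order, and nonzero by averaging a common fixed vector of the
reflections over the finite group that they generate (`det_pairing_pos`).

What remains is that the number of simple roots is the rank of `M`, and this is where semisimplicity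
enters (`dual_eq_zero_of_roots`). An additive functional on `M` that kills all roots gives a
one-parameter subgroup of `T` that acts trivially on the Lie algebra of `G`. An element `t` of `T`
that acts trivially on the Lie algebra acts trivially on the quotients `m ^ k / m ^ (k + 1)`, where
`m` is the maximal ideal at the identity. Therefore an eigenfunction of conjugation by `t` with an
eigenvalue other than `1` lies in all powers of `m`, and vanishes near the identity by Krull's
intersection theorem (`exists_mul_mem_vanishingIdeal`). As conjugation by `t` on matrices is
diagonalizable, the centralizer of `t` contains a neighbourhood of the identity in `G`, hence all of
the connected group `G` (`commute_of_trivial_on_lieAlg`). The closure of the one-parameter subgroup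
is then a closed connected central subgroup of `G`, so it is trivial (`cocharacter_eq_one`), and the
functional is zero.
-/

namespace AlgGrp

/-! ### Products of reflections -/

section Reflections

open Module

variable {ι R M : Type*} [Fintype ι] [DecidableEq ι] [CommRing R] [AddCommGroup M] [Module R M]

/-- If `w` is the product of the maps `x ↦ x - f i x • α i` along a list `l` without repetitions,
then `1 - w` factors as `x ↦ (f j x)_j ↦ B (f j x)_j ↦ ∑ i, (B (f j x)_j) i • α i`, where the matrix
`B` is supported on the rows in `l` and becomes unimodular once the other rows are filled with
those of the identity matrix. -/
theorem exists_matrix_sub_prod_preReflection (α : ι → M) (f : ι → Dual R M) (l : List ι)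
    (hl : l.Nodup) :
    ∃ B : Matrix ι ι R, (∀ i, i ∉ l → B i = 0) ∧
      (Matrix.diagonal (fun i => if i ∈ l then (0 : R) else 1) + B).det = 1 ∧
      ∀ x, x - (l.map fun i => preReflection (α i) (f i)).prod x =
        ∑ i, (B *ᵥ fun j => f j x) i • α i := by
  induction l with
  | nil => exact ⟨0, fun _ _ => rfl, by simp, by simp⟩
  | cons i l ih =>
    obtain ⟨hi, hl⟩ := List.nodup_cons.mp hl
    obtain ⟨B, hB0, hBdet, hB⟩ := ih hl
    let v : ι → R := fun k => f i (α k)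
    refine ⟨B.updateRow i (Pi.single i 1 - v ᵥ* B), ?_, ?_, ?_⟩
    · intro k hk
      rw [List.mem_cons, not_or] at hk
      ext j
      rw [Matrix.updateRow_ne hk.1, hB0 k hk.2]
    · set A := Matrix.diagonal (fun i => if i ∈ l then (0 : R) else 1) + B with hA
      -- the coefficients that express row `i` of the new matrix through the rows of `A`
      let c : ι → R := fun k => if k = i then 1 else if k ∈ l then - v k else 0
      have h1 := Matrix.det_updateRow_sum A i c
      rw [hBdet] at h1
      have hc : c i = 1 := by simp [c]
      rw [hc, one_smul] at h1
      refine Eq.trans ?_ h1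
      congr 1
      ext k j
      rcases eq_or_ne k i with rfl | hk
      · have hterm : ∀ m, c m • A m j = (if m = k then (Pi.single k 1 : ι → R) j else 0) -
            v m * B m j := by
          intro m
          rcases eq_or_ne m k with rfl | hmk
          · simp [c, hA, hB0 _ hi, hi, Matrix.diagonal_apply, Pi.single_apply, eq_comm]
          · by_cases hml : m ∈ l
            · simp [c, hA, hmk, hml, Matrix.diagonal_apply]
            · simp [c, hA, hmk, hml, Matrix.diagonal_apply, hB0 m hml]
        simp only [Matrix.add_apply, Matrix.updateRow_self, Finset.sum_apply, Pi.smul_apply]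
        rw [Finset.sum_congr rfl fun m _ => hterm m, Finset.sum_sub_distrib]
        simp [Matrix.diagonal_apply, Matrix.vecMul, dotProduct]
      · simp [hA, Matrix.diagonal_apply, hk]
    · intro x
      set y := (l.map fun i => preReflection (α i) (f i)).prod x with hy
      have h2 : ((i :: l).map fun i => preReflection (α i) (f i)).prod x = y - f i y • α i := by
        simp [preReflection_apply, hy]
      have h3 : f i y = f i x - ∑ k, (B *ᵥ fun j => f j x) k * v k := by
        have : y = x - ∑ i, (B *ᵥ fun j => f j x) i • α i := by rw [← hB x]; abel
        rw [this]
        simp [v]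
      have h4 : ∀ k, (B.updateRow i (Pi.single i 1 - v ᵥ* B) *ᵥ fun j => f j x) k =
          (B *ᵥ fun j => f j x) k + if k = i then f i y else 0 := by
        intro k
        rcases eq_or_ne k i with rfl | hk
        · have h5 : (B *ᵥ fun j => f j x) k = 0 := by simp [Matrix.mulVec, hB0 k hi]
          have h6 : ∑ m, (B *ᵥ fun j => f j x) m * v m = (v ᵥ* B) ⬝ᵥ fun j => f j x := by
            rw [← Matrix.dotProduct_mulVec, dotProduct_comm]
            rfl
          rw [h5, if_pos rfl, h3, h6, zero_add]
          change (B.updateRow k (Pi.single k 1 - v ᵥ* B) k) ⬝ᵥ (fun j => f j x) = _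
          rw [Matrix.updateRow_self, sub_dotProduct]
          simp
        · simp [Matrix.mulVec, hk]
      rw [h2]
      simp only [h4, add_smul, Finset.sum_add_distrib, ← hB x, ite_smul, zero_smul,
        Finset.sum_ite_eq', Finset.mem_univ, if_true]
      abel

/-- For a product `w` of reflections, in any order, in a family of as many vectors as the rank,
each reflection taken once, `det (1 - w)` is the determinant of the matrix of pairings. -/
theorem det_one_sub_prod_preReflection (b : Basis ι R M) (α : ι → M) (f : ι → Dual R M)
    (l : List ι) (hl : l.Nodup) (hall : ∀ i, i ∈ l) :
    LinearMap.det (1 - (l.map fun i => preReflection (α i) (f i)).prod) =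
      (Matrix.of fun i j => f j (α i)).det := by
  obtain ⟨B, -, hdet, hB⟩ := exists_matrix_sub_prod_preReflection α f l hl
  have hdet : B.det = 1 := by simpa [hall] using hdet
  let A : Matrix ι ι R := Matrix.of fun k i => b.repr (α i) k
  let F : Matrix ι ι R := Matrix.of fun j k => f j (b k)
  have h1 : LinearMap.toMatrix b b (1 - (l.map fun i => preReflection (α i) (f i)).prod) =
      A * B * F := by
    ext k m
    rw [LinearMap.toMatrix_apply, LinearMap.sub_apply, Module.End.one_apply, hB, Matrix.mul_assoc,
      Matrix.mul_apply]
    simp [A, F, Matrix.mul_apply, Matrix.mulVec, dotProduct, mul_comm]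
  have h2 : (Matrix.of fun i j => f j (α i))ᵀ = F * A := by
    ext j i
    have := congrArg (f j) (b.sum_repr (α i))
    simp only [map_sum, map_smul, smul_eq_mul] at this
    simp [F, A, Matrix.mul_apply, ← this, mul_comm]
  rw [← LinearMap.det_toMatrix b, h1, ← Matrix.det_transpose (Matrix.of _), h2, Matrix.det_mul,
    Matrix.det_mul, Matrix.det_mul, hdet, mul_one, mul_comm]

end Reflections

/-! ### Positivity -/

/-- A real matrix of finite order has `det (1 - A) ≥ 0`: on the path `s ↦ det (1 - s A)` from
`1` to `det (1 - A)` there is no zero with `0 ≤ s < 1`, since the eigenvalues of `A` are roots of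
unity. -/
theorem det_one_sub_nonneg_of_pow_eq_one {ι : Type*} [Fintype ι] [DecidableEq ι]
    (A : Matrix ι ι ℝ) {m : ℕ} (hm : m ≠ 0) (hA : A ^ m = 1) : 0 ≤ (1 - A).det := by
  by_contra! hneg
  have hcont : Continuous fun s : ℝ => (1 - s • A).det := by fun_prop
  obtain ⟨s, ⟨hs0, hs1⟩, hs⟩ := intermediate_value_Icc' (zero_le_one' ℝ) hcont.continuousOn
    (show (0 : ℝ) ∈ Set.Icc (1 - (1 : ℝ) • A).det (1 - (0 : ℝ) • A).det from
      ⟨by simpa using hneg.le, by simp⟩)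
  have hs1 : s < 1 := lt_of_le_of_ne hs1 (by rintro rfl; simp at hs; exact hneg.ne hs)
  obtain ⟨v, hv, hv0⟩ := Matrix.exists_mulVec_eq_zero_iff.mpr hs
  rw [Matrix.sub_mulVec, Matrix.one_mulVec, sub_eq_zero] at hv0
  have key : ∀ k : ℕ, v = (s ^ k) • (A ^ k) *ᵥ v := by
    intro k
    induction k with
    | zero => simp
    | succ k ih =>
      conv_lhs => rw [ih]
      nth_rewrite 1 [hv0]
      rw [pow_succ, pow_succ, Matrix.smul_mulVec, Matrix.mulVec_smul, Matrix.mulVec_mulVec,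
        mul_smul]
  have h := key m
  rw [hA, Matrix.one_mulVec] at h
  have h1 : s ^ m < 1 := pow_lt_one₀ hs0 hs1 hm
  have h2 : (1 - s ^ m) • v = 0 := by rw [sub_smul, one_smul, ← h, sub_self]
  rcases smul_eq_zero.mp h2 with h3 | h3
  · linarith
  · exact hv h3

/-- An endomorphism `u` of finite order of a lattice has `det (1 - u) ≥ 0`. -/
theorem linearMap_det_one_sub_nonneg_of_pow_eq_one {ι M : Type*} [Fintype ι] [DecidableEq ι]
    [AddCommGroup M] (b : Module.Basis ι ℤ M) (u : Module.End ℤ M) {m : ℕ} (hm : m ≠ 0)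
    (hu : u ^ m = 1) : 0 ≤ LinearMap.det (1 - u) := by
  let A := LinearMap.toMatrix b b u
  have hA : A ^ m = 1 := by
    rw [LinearMap.toMatrix_pow, hu, LinearMap.toMatrix_one]
  let φ := (Int.castRingHom ℝ)
  have h := det_one_sub_nonneg_of_pow_eq_one (φ.mapMatrix A) hm (by rw [← map_pow, hA, map_one])
  rw [← map_one φ.mapMatrix, ← map_sub, ← RingHom.map_det] at h
  have h2 : LinearMap.det (1 - u) = (1 - A).det := by
    rw [← LinearMap.det_toMatrix b, map_sub, LinearMap.toMatrix_one]
  rw [h2]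
  simpa [φ] using h

/-- If the reflections `x ↦ x - f i x • α i` generate a finite group, the `α i` being linearly
independent, then the matrix of pairings is nonsingular: for a vector `x = ∑ v i • α i` that all
reflections fix, averaging over the group gives `x` on the one hand and `0` on the other, since
each `α i` is sent to its negative by a group element. -/
theorem det_pairing_ne_zero {ι M : Type*} [Fintype ι] [DecidableEq ι]
    [AddCommGroup M] [Module.IsTorsionFree ℤ M] (α : ι → M) (hα : LinearIndependent ℤ α)
    (f : ι → Module.Dual ℤ M) (hf : ∀ i, f i (α i) = 2) (W : Subgroup (M ≃ₗ[ℤ] M))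
    (hW : W = Subgroup.closure (Set.range fun i => Module.reflection (hf i)))
    (hfin : Finite W) : (Matrix.of fun i j => f j (α i)).det ≠ 0 := by
  intro hdet
  rw [← Matrix.det_transpose] at hdet
  obtain ⟨v, hv, hv0⟩ := Matrix.exists_mulVec_eq_zero_iff.mpr hdet
  set x := ∑ i, v i • α i with hx
  have hfx : ∀ j, f j x = 0 := by
    intro j
    have := congrFun hv0 j
    simpa [Matrix.mulVec, dotProduct, hx, mul_comm] using this
  have hmem : ∀ i, Module.reflection (hf i) ∈ W := fun i => by
    rw [hW]; exact Subgroup.subset_closure ⟨i, rfl⟩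
  have hWx : ∀ g ∈ W, g x = x := by
    intro g hg
    rw [hW] at hg
    induction hg using Subgroup.closure_induction with
    | mem g hg =>
      obtain ⟨i, rfl⟩ := hg
      simp [Module.reflection_apply, hfx]
    | one => rfl
    | mul g h _ _ hg hh =>
      change g (h x) = x
      rw [hh, hg]
    | inv g _ hg =>
      change g.symm x = x
      rw [LinearEquiv.symm_apply_eq]; exact hg.symm
  have := Fintype.ofFinite W
  have hsum : ∀ i, ∑ g : W, (g : M ≃ₗ[ℤ] M) (α i) = 0 := by
    intro i
    have h1 : ∑ g : W, (g : M ≃ₗ[ℤ] M) (α i) = ∑ g : W, -((g : M ≃ₗ[ℤ] M) (α i)) := by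
      refine Fintype.sum_equiv (Equiv.mulRight ⟨Module.reflection (hf i), hmem i⟩) _ _ fun g => ?_
      change (g : M ≃ₗ[ℤ] M) (α i) = -((g : M ≃ₗ[ℤ] M) (Module.reflection (hf i) (α i)))
      rw [Module.reflection_apply_self, map_neg, neg_neg]
    rw [Finset.sum_neg_distrib] at h1
    rw [eq_neg_iff_add_eq_zero, ← two_zsmul] at h1
    exact (smul_eq_zero.mp h1).resolve_left two_ne_zero
  have h2 : ∑ g : W, (g : M ≃ₗ[ℤ] M) x = 0 := by
    simp only [hx, map_sum, map_smul]
    rw [Finset.sum_comm]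
    simp [← Finset.smul_sum, hsum]
  rw [Finset.sum_congr rfl fun (g : W) _ => hWx (g : M ≃ₗ[ℤ] M) g.2, Finset.sum_const,
    Finset.card_univ] at h2
  have hx0 : x = 0 := by
    rw [← natCast_zsmul] at h2
    exact (smul_eq_zero.mp h2).resolve_left (by exact_mod_cast Fintype.card_ne_zero)
  exact hv (funext (Fintype.linearIndependent_iff.mp hα v hx0))

/-! ### Homomorphisms from a lattice to the multiplicative group -/

section Counting

open Module

variable {K : Type*} [Field K]

theorem finite_zpow_eq_one {a : ℤ} (ha : a ≠ 0) : Finite {x : Kˣ // x ^ a = 1} := by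
  have : NeZero a.natAbs := ⟨Int.natAbs_ne_zero.mpr ha⟩
  refine Finite.of_injective (β := rootsOfUnity a.natAbs K)
    (fun x => ⟨x.1, by rw [mem_rootsOfUnity, pow_natAbs_eq_one]; exact x.2⟩) ?_
  intro x y hxy
  exact Subtype.ext (congrArg (fun z : rootsOfUnity a.natAbs K => (z : Kˣ)) hxy)

theorem card_zpow_eq_one (a : ℤ) :
    Nat.card {x : Kˣ // x ^ a = 1} = Nat.card (rootsOfUnity a.natAbs K) :=
  Nat.card_congr (Equiv.subtypeEquivRight fun x => by rw [mem_rootsOfUnity, pow_natAbs_eq_one])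

theorem card_rootsOfUnity_of_charZero [IsAlgClosed K] [CharZero K] {m : ℕ} (hm : m ≠ 0) :
    Nat.card (rootsOfUnity m K) = m := by
  have : NeZero m := ⟨hm⟩
  exact HasEnoughRootsOfUnity.natCard_rootsOfUnity K m

/-- In characteristic `p` the roots of unity of `p`-power order are trivial. -/
theorem card_rootsOfUnity_of_charP [IsAlgClosed K] {p : ℕ} (hp : p.Prime) [CharP K p] {m : ℕ}
    (hm : m ≠ 0) : Nat.card (rootsOfUnity m K) = ordCompl[p] m := by
  have : ExpChar K p := ExpChar.prime hp
  have h : rootsOfUnity m K = rootsOfUnity (ordCompl[p] m) K := by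
    ext ζ
    conv_lhs => rw [← Nat.ordProj_mul_ordCompl_eq_self m p]
    exact mem_rootsOfUnity_prime_pow_mul_iff K p _ _
  have : NeZero ((ordCompl[p] m : ℕ) : K) :=
    ⟨fun h => Nat.not_dvd_ordCompl hp hm ((CharP.cast_eq_zero_iff K p _).mp h)⟩
  have : NeZero (ordCompl[p] m) := ⟨(Nat.ordCompl_pos p hm).ne'⟩
  rw [h]
  exact HasEnoughRootsOfUnity.natCard_rootsOfUnity K _

variable {ι M : Type*} [Fintype ι] [DecidableEq ι] [AddCommGroup M]

/-- The homomorphisms `M → Kˣ` that kill the image of an injective endomorphism `u` of a lattice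
`M` correspond, through the Smith normal form of `u`, to the families of solutions of equations
`x ^ a i = 1`, where the product of the `a i` is `± det u`. -/
theorem exists_equiv_homs_killing_range (b : Basis ι ℤ M) (u : Module.End ℤ M)
    (hu : LinearMap.det u ≠ 0) :
    ∃ a : ι → ℤ, (∏ i, a i).natAbs = (LinearMap.det u).natAbs ∧
      Nonempty ({φ : M →ₗ[ℤ] Additive Kˣ // ∀ x, φ (u x) = 0} ≃
        ∀ i, {x : Kˣ // x ^ a i = 1}) := by
  have : Module.Free ℤ M := Module.Free.of_basis b
  have : Module.Finite ℤ M := Module.Finite.of_basis b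
  have hinj : Function.Injective u := by
    have h := (LinearMap.det_toMatrix b u).symm ▸ hu
    rw [injective_iff_map_eq_zero]
    intro x hx
    have h1 : LinearMap.toMatrix b b u *ᵥ b.repr x = 0 := by
      rw [LinearMap.toMatrix_mulVec_repr, hx]; simp
    have h2 := Matrix.eq_zero_of_mulVec_eq_zero h h1
    apply b.repr.injective
    rw [map_zero]
    exact DFunLike.coe_injective h2
  obtain ⟨b', a, ab, hab⟩ := Submodule.exists_smith_normal_form_of_rank_eq b
    (LinearMap.finrank_range_of_inj hinj)
  refine ⟨a, ?_, ⟨?_⟩⟩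
  · let e : M ≃ₗ[ℤ] LinearMap.range u := LinearEquiv.ofInjective u hinj
    let e' : M ≃ₗ[ℤ] LinearMap.range u := b'.equiv ab (Equiv.refl ι)
    have h := LinearMap.associated_det_comp_equiv (LinearMap.range u).subtype e' e
    have h1 : (LinearMap.range u).subtype ∘ₗ (e : M →ₗ[ℤ] LinearMap.range u) = u := rfl
    have h2 : LinearMap.det ((LinearMap.range u).subtype ∘ₗ (e' : M →ₗ[ℤ] LinearMap.range u)) =
        ∏ i, a i := by
      rw [← LinearMap.det_toMatrix b', ← Matrix.det_diagonal]
      congr 1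
      ext i j
      rw [LinearMap.toMatrix_apply]
      rcases eq_or_ne i j with rfl | hij
      · simp [e', hab]
      · simp [e', hab, hij]
    rw [h1, h2] at h
    exact Int.natAbs_eq_iff_associated.mpr h
  · have hiff : ∀ φ : M →ₗ[ℤ] Additive Kˣ, (∀ x, φ (u x) = 0) ↔
        ∀ i, (Additive.toMul (φ (b' i))) ^ a i = 1 := by
      intro φ
      have h0 : ∀ i, (Additive.toMul (φ (b' i))) ^ a i = Additive.toMul (φ (ab i : M)) := by
        intro i
        rw [hab, map_smul, toMul_zsmul]
      constructor
      · intro h i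
        obtain ⟨x, hx⟩ := (ab i).2
        rw [h0, ← hx, h x, toMul_zero]
      · intro h x
        have : φ.comp (LinearMap.range u).subtype = 0 := by
          refine ab.ext fun i => ?_
          have := h i
          rw [h0] at this
          exact this
        exact LinearMap.congr_fun this ⟨u x, x, rfl⟩
    let E : (M →ₗ[ℤ] Additive Kˣ) ≃ (ι → Kˣ) :=
      { toFun := fun φ i => Additive.toMul (φ (b' i))
        invFun := fun x => b'.constr ℤ fun i => Additive.ofMul (x i)
        left_inv := fun φ => b'.ext fun i => by simp
        right_inv := fun x => by ext i; simp }
    exact (E.subtypeEquiv (q := fun x => ∀ i, x i ^ a i = 1) hiff).trans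
      (Equiv.subtypePiEquivPi (p := fun i (x : Kˣ) => x ^ a i = 1))

theorem finite_homs_killing_range (b : Basis ι ℤ M) (u : Module.End ℤ M)
    (hu : LinearMap.det u ≠ 0) : Finite {φ : M →ₗ[ℤ] Additive Kˣ // ∀ x, φ (u x) = 0} := by
  obtain ⟨a, ha, ⟨E⟩⟩ := exists_equiv_homs_killing_range (K := K) b u hu
  have h0 : ∏ i, a i ≠ 0 := by
    rw [← Int.natAbs_ne_zero, ha]; exact Int.natAbs_ne_zero.mpr hu
  have : ∀ i, Finite {x : Kˣ // x ^ a i = 1} := fun i =>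
    finite_zpow_eq_one (Finset.prod_ne_zero_iff.mp h0 i (Finset.mem_univ i))
  exact Finite.of_equiv _ E.symm

theorem card_homs_killing_range_of_charZero [IsAlgClosed K] [CharZero K] (b : Basis ι ℤ M)
    (u : Module.End ℤ M) (hu : LinearMap.det u ≠ 0) :
    Nat.card {φ : M →ₗ[ℤ] Additive Kˣ // ∀ x, φ (u x) = 0} = (LinearMap.det u).natAbs := by
  obtain ⟨a, ha, ⟨E⟩⟩ := exists_equiv_homs_killing_range (K := K) b u hu
  have h0 : ∏ i, a i ≠ 0 := by
    rw [← Int.natAbs_ne_zero, ha]; exact Int.natAbs_ne_zero.mpr hu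
  rw [Nat.card_congr E, Nat.card_pi, ← ha, ← Int.natAbsHom_apply, map_prod]
  refine Finset.prod_congr rfl fun i _ => ?_
  rw [card_zpow_eq_one, card_rootsOfUnity_of_charZero, Int.natAbsHom_apply]
  exact Int.natAbs_ne_zero.mpr (Finset.prod_ne_zero_iff.mp h0 i (Finset.mem_univ i))

theorem card_homs_killing_range_of_charP [IsAlgClosed K] {p : ℕ} (hp : p.Prime) [CharP K p]
    (b : Basis ι ℤ M) (u : Module.End ℤ M) (hu : LinearMap.det u ≠ 0) :
    Nat.card {φ : M →ₗ[ℤ] Additive Kˣ // ∀ x, φ (u x) = 0} =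
      ordCompl[p] (LinearMap.det u).natAbs := by
  obtain ⟨a, ha, ⟨E⟩⟩ := exists_equiv_homs_killing_range (K := K) b u hu
  have h0 : ∏ i, a i ≠ 0 := by
    rw [← Int.natAbs_ne_zero, ha]; exact Int.natAbs_ne_zero.mpr hu
  let c : ℕ →* ℕ :=
    { toFun := fun m => ordCompl[p] m
      map_one' := by simp
      map_mul' := fun x y => Nat.ordCompl_mul x y p }
  have hc : ordCompl[p] (LinearMap.det u).natAbs = c (LinearMap.det u).natAbs := rfl
  rw [hc, Nat.card_congr E, Nat.card_pi, ← ha, ← Int.natAbsHom_apply, map_prod, map_prod]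
  refine Finset.prod_congr rfl fun i _ => ?_
  rw [card_zpow_eq_one, card_rootsOfUnity_of_charP hp]
  · rfl
  exact Int.natAbs_ne_zero.mpr (Finset.prod_ne_zero_iff.mp h0 i (Finset.mem_univ i))

end Counting

/-! ### Characters of a torus -/

section Torus

open Module

variable {K : Type*} [Field K] {n : ℕ} {T : Subgroup (GL (Fin n) K)}

theorem infinite_units [Infinite K] : Infinite Kˣ := by
  have : Infinite {x : K // x ≠ 0} := (Set.finite_singleton (0 : K)).infinite_compl.to_subtype
  exact Infinite.of_injective unitsEquivNeZero.symm unitsEquivNeZero.symm.injective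

theorem charEval_add (χ ψ : CharLattice T) (t : T) :
    charEval (χ + ψ) t = charEval χ t * charEval ψ t := rfl

theorem charEval_zero (t : T) : charEval (0 : CharLattice T) t = 1 := rfl

theorem charEval_mul (χ : CharLattice T) (s t : T) :
    charEval χ (s * t) = charEval χ s * charEval χ t :=
  map_mul (Additive.toMul χ : charGroup T).1 s t

theorem charEval_one (χ : CharLattice T) : charEval χ (1 : T) = 1 :=
  map_one (Additive.toMul χ : charGroup T).1

theorem charEval_mem_coordRing (χ : CharLattice T) :
    (fun t => (charEval χ t : K)) ∈ coordRing T :=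
  (Additive.toMul χ : charGroup T).2

theorem charLattice_ext {χ ψ : CharLattice T} (h : ∀ t, charEval χ t = charEval ψ t) : χ = ψ := by
  apply Additive.toMul.injective
  exact Subtype.ext (MonoidHom.ext h)

/-- Evaluation of all characters at the point `t`. -/
def evalHom (t : T) : CharLattice T →ₗ[ℤ] Additive Kˣ :=
  AddMonoidHom.toIntLinearMap
    { toFun := fun χ => Additive.ofMul (charEval χ t)
      map_zero' := rfl
      map_add' := fun _ _ => rfl }

theorem charEval_zsmul (a : ℤ) (χ : CharLattice T) (t : T) :
    charEval (a • χ) t = charEval χ t ^ a := by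
  have h := map_zsmul (evalHom t) a χ
  exact h

theorem charEval_sum {ι : Type*} (s : Finset ι) (χ : ι → CharLattice T) (t : T) :
    charEval (∑ i ∈ s, χ i) t = ∏ i ∈ s, charEval (χ i) t :=
  map_sum (evalHom t) χ s

/-- Dedekind's theorem on the independence of characters. -/
theorem linearIndependent_charEval :
    LinearIndependent K fun (χ : CharLattice T) (t : T) => (charEval χ t : K) := by
  have h := (linearIndependent_monoidHom T K).comp
    (fun χ : CharLattice T => (Units.coeHom K).comp (Additive.toMul χ : charGroup T).1) (by
      intro χ ψ h
      refine charLattice_ext fun t => Units.ext ?_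
      exact DFunLike.congr_fun h t)
  exact h

/-- If the coordinates `t ↦ e t i` on a torus are the characters `X i`, then every regular function
is a linear combination of monomials in them, which are the characters in the span of the `X i`. -/
theorem coordRing_le_span {r : ℕ} (e : T ≃* (Fin r → Kˣ))
    (he : IsRegularMap (torusRing r K) (coordRing T) e.symm)
    (X : Fin r → CharLattice T) (hX : ∀ i t, charEval (X i) t = e t i) {h : T → K}
    (hh : h ∈ coordRing T) :
    h ∈ Submodule.span K ((fun (χ : CharLattice T) (t : T) => (charEval χ t : K)) ''
      (Submodule.span ℤ (Set.range X) : Set (CharLattice T))) := by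
  have hmon : ∀ m ∈ Submonoid.closure
      ((Set.range fun i : Fin r => fun x : Fin r → Kˣ => (x i : K)) ∪
        (Set.range fun i : Fin r => fun x : Fin r → Kˣ => ((x i)⁻¹ : K))),
      ∃ χ ∈ Submodule.span ℤ (Set.range X), ∀ t, m (e t) = (charEval χ t : K) := by
    intro m hm
    induction hm using Submonoid.closure_induction with
    | mem m hm =>
      rcases hm with ⟨i, rfl⟩ | ⟨i, rfl⟩
      · exact ⟨X i, Submodule.subset_span ⟨i, rfl⟩, fun t => by rw [hX]⟩
      · refine ⟨(-1 : ℤ) • X i, Submodule.smul_mem _ _ (Submodule.subset_span ⟨i, rfl⟩),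
          fun t => ?_⟩
        rw [charEval_zsmul, hX]
        simp
    | one => exact ⟨0, Submodule.zero_mem _, fun t => by rw [charEval_zero]; rfl⟩
    | mul m m' _ _ hm hm' =>
      obtain ⟨χ, hχ, h1⟩ := hm
      obtain ⟨ψ, hψ, h2⟩ := hm'
      refine ⟨χ + ψ, Submodule.add_mem _ hχ hψ, fun t => ?_⟩
      rw [charEval_add, Pi.mul_apply, h1, h2, Units.val_mul]
  have h1 : h ∘ e.symm ∈ Subalgebra.toSubmodule (torusRing r K) := he h hh
  rw [torusRing, Algebra.adjoin_eq_span] at h1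
  have key : ∀ q : (Fin r → Kˣ) → K, q ∈ Submodule.span K (Submonoid.closure
      ((Set.range fun i : Fin r => fun x : Fin r → Kˣ => (x i : K)) ∪
        (Set.range fun i : Fin r => fun x : Fin r → Kˣ => ((x i)⁻¹ : K))) :
          Set ((Fin r → Kˣ) → K)) →
      (q ∘ e) ∈ Submodule.span K ((fun (χ : CharLattice T) (t : T) => (charEval χ t : K)) ''
        (Submodule.span ℤ (Set.range X) : Set (CharLattice T))) := by
    intro q hq
    induction hq using Submodule.span_induction with
    | mem q hq =>
      obtain ⟨χ, hχ, h2⟩ := hmon q hq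
      exact Submodule.subset_span ⟨χ, hχ, funext fun t => (h2 t).symm⟩
    | zero => exact Submodule.zero_mem _
    | add q q' _ _ hq hq' => exact Submodule.add_mem _ hq hq'
    | smul a q _ hq => exact Submodule.smul_mem _ a hq
  have h2 := key _ h1
  have h3 : (h ∘ e.symm) ∘ e = h := by funext t; simp
  rwa [h3] at h2

/-- A torus has a lattice of characters with a basis whose members are coordinates, and its
regular functions are combinations of characters. -/
theorem IsTorus.exists_basis [Infinite K] (hT : IsTorus T) :
    (∃ (r : ℕ) (b : Basis (Fin r) ℤ (CharLattice T)),
      Function.Bijective fun (t : T) (i : Fin r) => charEval (b i) t) ∧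
    ∀ h ∈ coordRing T, h ∈ Submodule.span K
      (Set.range fun (χ : CharLattice T) (t : T) => (charEval χ t : K)) := by
  obtain ⟨-, r, e, he, he'⟩ := hT
  let X : Fin r → CharLattice T := fun i => Additive.ofMul
    ⟨(Pi.evalMonoidHom (fun _ : Fin r => Kˣ) i).comp e.toMonoidHom,
      he _ (Algebra.subset_adjoin (Or.inl ⟨i, rfl⟩))⟩
  have hX : ∀ i t, charEval (X i) t = e t i := fun i t => rfl
  refine ⟨⟨r, Basis.mk (v := X) ?_ ?_, ?_⟩, fun h hh => ?_⟩
  · rw [Fintype.linearIndependent_iff]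
    intro a ha i
    by_contra hai
    have hfin := finite_zpow_eq_one (K := K) hai
    have hinf : Infinite Kˣ := infinite_units
    -- evaluating at the points whose only nontrivial coordinate is the `i`-th one gives
    -- `z ^ a i = 1` for all `z`
    refine hinf.not_finite (Finite.of_injective
      (fun z : Kˣ => (⟨z, ?_⟩ : {x : Kˣ // x ^ a i = 1})) fun z w h => congrArg Subtype.val h)
    have h := congrArg (fun χ => charEval χ (e.symm (Pi.mulSingle i z))) ha
    simp only [charEval_sum, charEval_zsmul, hX, MulEquiv.apply_symm_apply, charEval_zero] at h
    rw [Finset.prod_eq_single i] at h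
    · simpa using h
    · intro j _ hj
      simp [Pi.mulSingle_eq_of_ne hj]
    · simp
  · intro χ _
    by_contra hχ
    exact linearIndependent_charEval.notMem_span_image hχ
      (coordRing_le_span e he' X hX (charEval_mem_coordRing χ))
  · simp only [Basis.mk_apply, hX]
    exact e.bijective
  · exact Submodule.span_mono (Set.image_subset_range _ _) (coordRing_le_span e he' X hX hh)

theorem IsTorus.bijective_evalHom [Infinite K] (hT : IsTorus T) :
    Function.Bijective (evalHom : T → (CharLattice T →ₗ[ℤ] Additive Kˣ)) := by
  obtain ⟨⟨r, b, hb⟩, -⟩ := hT.exists_basis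
  constructor
  · intro s t h
    refine hb.1 (funext fun i => ?_)
    exact LinearMap.congr_fun h (b i)
  · intro φ
    obtain ⟨t, ht⟩ := hb.2 fun i => Additive.toMul (φ (b i))
    exact ⟨t, b.ext fun i => congrFun ht i⟩

/-- Every additive functional on the character lattice comes from a one-parameter subgroup. -/
theorem IsTorus.exists_cocharacter [Infinite K] (hT : IsTorus T)
    (g : Dual ℤ (CharLattice T)) :
    ∃ l : Kˣ →* T, ∀ z χ, charEval χ (l z) = z ^ g χ := by
  let E := Equiv.ofBijective _ hT.bijective_evalHom
  let φ : Kˣ → (CharLattice T →ₗ[ℤ] Additive Kˣ) := fun z =>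
    (AddMonoidHom.toIntLinearMap (zmultiplesHom (Additive Kˣ) (Additive.ofMul z))) ∘ₗ g
  have h : ∀ z χ, charEval χ (E.symm (φ z)) = z ^ g χ := by
    intro z χ
    have h1 : evalHom (E.symm (φ z)) = φ z := E.apply_symm_apply (φ z)
    exact LinearMap.congr_fun h1 χ
  refine ⟨MonoidHom.mk' (fun z => E.symm (φ z)) fun z w => ?_, h⟩
  apply E.injective
  refine LinearMap.ext fun χ => ?_
  change charEval χ (E.symm (φ (z * w))) = charEval χ (E.symm (φ z) * E.symm (φ w))
  rw [charEval_mul, h, h, h, mul_zpow]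

/-! ### Weights of a torus on matrices -/

/-- Conjugation by an invertible matrix, as a linear map on matrices. -/
def conjLin (g : GL (Fin n) K) : Matrix (Fin n) (Fin n) K →ₗ[K] Matrix (Fin n) (Fin n) K :=
  LinearMap.mulLeftRight K ((g : Matrix (Fin n) (Fin n) K),
    ((g⁻¹ : GL (Fin n) K) : Matrix (Fin n) (Fin n) K))

theorem conjLin_apply (g : GL (Fin n) K) (X : Matrix (Fin n) (Fin n) K) :
    conjLin g X = (g : Matrix (Fin n) (Fin n) K) * X *
      ((g⁻¹ : GL (Fin n) K) : Matrix (Fin n) (Fin n) K) := rfl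

theorem conjLin_mul (g h : GL (Fin n) K) (X : Matrix (Fin n) (Fin n) K) :
    conjLin (g * h) X = conjLin g (conjLin h X) := by
  simp only [conjLin_apply, _root_.mul_inv_rev, Units.val_mul, Matrix.mul_assoc]

theorem conjLin_one (X : Matrix (Fin n) (Fin n) K) : conjLin 1 X = X := by
  simp [conjLin_apply]

theorem conjLin_coe (g h : GL (Fin n) K) :
    conjLin g (h : Matrix (Fin n) (Fin n) K) = ((g * h * g⁻¹ : GL (Fin n) K) :
      Matrix (Fin n) (Fin n) K) := by
  simp [conjLin_apply]

theorem conjLin_apply_apply (g : GL (Fin n) K) (X : Matrix (Fin n) (Fin n) K) (i j : Fin n) :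
    conjLin g X i j = ∑ k, ∑ l, X k l * ((g : Matrix (Fin n) (Fin n) K) i k *
      ((g⁻¹ : GL (Fin n) K) : Matrix (Fin n) (Fin n) K) l j) := by
  rw [conjLin_apply, Matrix.mul_apply]
  simp only [Matrix.mul_apply, Finset.sum_mul]
  rw [Finset.sum_comm]
  exact Finset.sum_congr rfl fun k _ => Finset.sum_congr rfl fun l _ => by ring

theorem eq_zero_of_sum_charEval {S : Finset (CharLattice T)} {u : CharLattice T → K}
    (h : ∀ t : T, ∑ χ ∈ S, u χ * (charEval χ t : K) = 0) : ∀ χ ∈ S, u χ = 0 := by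
  have h0 : ∑ χ ∈ S, u χ • (fun t : T => (charEval χ t : K)) = 0 := by
    funext t
    rw [Finset.sum_apply]
    exact h t
  have h1 := linearIndependent_iff'.mp (linearIndependent_charEval (T := T)) S u h0
  exact h1

/-- Coefficients of characters can be compared. -/
theorem eq_of_sum_charEval_smul_eq {S : Finset (CharLattice T)}
    {u v : CharLattice T → Matrix (Fin n) (Fin n) K}
    (h : ∀ t : T, ∑ χ ∈ S, (charEval χ t : K) • u χ = ∑ χ ∈ S, (charEval χ t : K) • v χ) :
    ∀ χ ∈ S, u χ = v χ := by
  intro χ hχ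
  ext i j
  rw [← sub_eq_zero]
  refine eq_zero_of_sum_charEval (u := fun χ => u χ i j - v χ i j) (fun t => ?_) χ hχ
  have h1 := congrFun (congrFun (h t) i) j
  simp only [Matrix.sum_apply, Matrix.smul_apply, smul_eq_mul] at h1
  simp only [sub_mul, Finset.sum_sub_distrib]
  rw [sub_eq_zero]
  simpa only [mul_comm] using h1

/-- The weight decomposition of matrices under conjugation by a torus: finitely many characters,
and for each of them a linear projection onto its weight space, which commutes with the action. -/
theorem IsTorus.exists_weight_projections [Infinite K] (hT : IsTorus T) :
    ∃ (S : Finset (CharLattice T))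
      (π : CharLattice T → Matrix (Fin n) (Fin n) K →ₗ[K] Matrix (Fin n) (Fin n) K),
      (∀ (t : T) X, conjLin (t : GL (Fin n) K) X = ∑ χ ∈ S, (charEval χ t : K) • π χ X) ∧
      (∀ χ ∈ S, ∀ (t : T) X, conjLin (t : GL (Fin n) K) (π χ X) = (charEval χ t : K) • π χ X) ∧
      (∀ χ ∈ S, ∀ (t : T) X, π χ (conjLin (t : GL (Fin n) K) X) = (charEval χ t : K) • π χ X) := by
  classical
  have hC : ∀ i k l j : Fin n, ∃ c : CharLattice T →₀ K, ∀ t : T,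
      (c.sum fun χ a => a * (charEval χ t : K)) =
        ((t : GL (Fin n) K) : Matrix (Fin n) (Fin n) K) i k *
          (((t : GL (Fin n) K)⁻¹ : GL (Fin n) K) : Matrix (Fin n) (Fin n) K) l j := by
    intro i k l j
    have hmem : (fun t : T => ((t : GL (Fin n) K) : Matrix (Fin n) (Fin n) K) i k) *
        (fun t : T => (((t : GL (Fin n) K)⁻¹ : GL (Fin n) K) : Matrix (Fin n) (Fin n) K) l j) ∈
        coordRing T :=
      (coordRing T).mul_mem (Algebra.subset_adjoin (Or.inl ⟨(i, k), rfl⟩))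
        (Algebra.subset_adjoin (Or.inr ⟨(l, j), rfl⟩))
    obtain ⟨c, hc⟩ := Finsupp.mem_span_range_iff_exists_finsupp.mp (hT.exists_basis.2 _ hmem)
    refine ⟨c, fun t => ?_⟩
    have := congrFun hc t
    simpa [Finsupp.sum] using this
  choose C hC using hC
  let S : Finset (CharLattice T) := Finset.univ.biUnion fun q : (Fin n × Fin n) × (Fin n × Fin n) =>
    (C q.1.1 q.1.2 q.2.1 q.2.2).support
  let π : CharLattice T → Matrix (Fin n) (Fin n) K →ₗ[K] Matrix (Fin n) (Fin n) K := fun χ =>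
    { toFun := fun X => Matrix.of fun i j => ∑ k, ∑ l, X k l * C i k l j χ
      map_add' := fun X Y => by
        ext i j; simp [add_mul, Finset.sum_add_distrib]
      map_smul' := fun a X => by
        ext i j; simp [mul_assoc, Finset.mul_sum] }
  have h1 : ∀ (t : T) X, conjLin (t : GL (Fin n) K) X = ∑ χ ∈ S, (charEval χ t : K) • π χ X := by
    intro t X
    ext i j
    rw [conjLin_apply_apply]
    simp only [Matrix.sum_apply, Matrix.smul_apply, smul_eq_mul, π, LinearMap.coe_mk,
      AddHom.coe_mk, Matrix.of_apply, Finset.mul_sum]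
    conv_rhs => rw [Finset.sum_comm]
    refine Finset.sum_congr rfl fun k _ => ?_
    conv_rhs => rw [Finset.sum_comm]
    refine Finset.sum_congr rfl fun l _ => ?_
    have hS : (C i k l j).support ⊆ S := fun χ hχ =>
      Finset.mem_biUnion.mpr ⟨((i, k), (l, j)), Finset.mem_univ _, hχ⟩
    rw [← hC i k l j t, Finsupp.sum_of_support_subset (C i k l j) hS
      (fun χ a => a * (charEval χ t : K)) (by simp), Finset.mul_sum]
    exact Finset.sum_congr rfl fun χ _ => by ring
  refine ⟨S, π, h1, fun χ hχ t X => ?_, fun χ hχ t X => ?_⟩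
  · refine eq_of_sum_charEval_smul_eq (u := fun χ => conjLin (t : GL (Fin n) K) (π χ X))
      (v := fun χ => (charEval χ t : K) • π χ X) (fun s => ?_) χ hχ
    have h2 := conjLin_mul (t : GL (Fin n) K) (s : GL (Fin n) K) X
    rw [← Subgroup.coe_mul, h1 (t * s) X, h1 s X, map_sum] at h2
    simp only [map_smul] at h2
    rw [← h2]
    refine Finset.sum_congr rfl fun χ _ => ?_
    rw [charEval_mul, Units.val_mul, smul_smul, _root_.mul_comm]
  · refine eq_of_sum_charEval_smul_eq (u := fun χ => π χ (conjLin (t : GL (Fin n) K) X))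
      (v := fun χ => (charEval χ t : K) • π χ X) (fun s => ?_) χ hχ
    have h2 := conjLin_mul (s : GL (Fin n) K) (t : GL (Fin n) K) X
    rw [← Subgroup.coe_mul, h1 (s * t) X, h1 s] at h2
    rw [← h2]
    refine Finset.sum_congr rfl fun χ _ => ?_
    rw [charEval_mul, Units.val_mul, smul_smul]

end Torus

/-! ### Polynomial functions on matrices and their differentials at the identity -/

section Polynomials

open MvPolynomial

variable {K : Type*} [Field K] {n : ℕ}

/-- The value of a polynomial in the matrix entries at a matrix. -/
noncomputable def evalMat (X : Matrix (Fin n) (Fin n) K) : MvPolynomial (Fin n × Fin n) K →ₐ[K] K :=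
  aeval fun ij => X ij.1 ij.2

theorem evalMat_eq (X : Matrix (Fin n) (Fin n) K) (p : MvPolynomial (Fin n × Fin n) K) :
    evalMat X p = eval (fun ij => X ij.1 ij.2) p :=
  congrArg (fun φ : MvPolynomial (Fin n × Fin n) K →+* K => φ p)
    (coe_aeval_eq_eval (fun ij : Fin n × Fin n => X ij.1 ij.2))

@[simp] theorem evalMat_X (Y : Matrix (Fin n) (Fin n) K) (ij : Fin n × Fin n) :
    evalMat Y (X ij) = Y ij.1 ij.2 := aeval_X _ _

@[simp] theorem evalMat_C (Y : Matrix (Fin n) (Fin n) K) (a : K) :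
    evalMat Y (C a) = a := by simp [evalMat]

/-- The linear polynomial that gives the `(i, j)` entry of `L X`. -/
noncomputable def linPoly (L : Matrix (Fin n) (Fin n) K →ₗ[K] Matrix (Fin n) (Fin n) K)
    (ij : Fin n × Fin n) : MvPolynomial (Fin n × Fin n) K :=
  ∑ kl : Fin n × Fin n, C (L (Matrix.single kl.1 kl.2 1) ij.1 ij.2) * X kl

/-- Substitution of a linear map into polynomial functions, `p ↦ p ∘ L`. -/
noncomputable def substLin (L : Matrix (Fin n) (Fin n) K →ₗ[K] Matrix (Fin n) (Fin n) K) :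
    MvPolynomial (Fin n × Fin n) K →ₐ[K] MvPolynomial (Fin n × Fin n) K :=
  aeval (linPoly L)

theorem sum_apply_single_mul (L : Matrix (Fin n) (Fin n) K →ₗ[K] Matrix (Fin n) (Fin n) K)
    (Y : Matrix (Fin n) (Fin n) K) (ij : Fin n × Fin n) :
    ∑ kl : Fin n × Fin n, L (Matrix.single kl.1 kl.2 1) ij.1 ij.2 * Y kl.1 kl.2 =
      L Y ij.1 ij.2 := by
  conv_rhs => rw [Matrix.matrix_eq_sum_single Y]
  rw [Fintype.sum_prod_type]
  simp only [map_sum, Matrix.sum_apply]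
  refine Finset.sum_congr rfl fun k _ => Finset.sum_congr rfl fun l _ => ?_
  have : Matrix.single k l (Y k l) = Y k l • Matrix.single k l (1 : K) := by
    rw [Matrix.smul_single, smul_eq_mul, mul_one]
  rw [this, map_smul, Matrix.smul_apply, smul_eq_mul, mul_comm]

theorem evalMat_linPoly (L : Matrix (Fin n) (Fin n) K →ₗ[K] Matrix (Fin n) (Fin n) K)
    (Y : Matrix (Fin n) (Fin n) K) (ij : Fin n × Fin n) :
    evalMat Y (linPoly L ij) = L Y ij.1 ij.2 := by
  simp only [linPoly, map_sum, map_mul, evalMat_C, evalMat_X, sum_apply_single_mul]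

theorem evalMat_substLin (L : Matrix (Fin n) (Fin n) K →ₗ[K] Matrix (Fin n) (Fin n) K)
    (Y : Matrix (Fin n) (Fin n) K) (p : MvPolynomial (Fin n × Fin n) K) :
    evalMat Y (substLin L p) = evalMat (L Y) p := by
  have : (evalMat Y).comp (substLin L) = evalMat (L Y) := by
    refine MvPolynomial.algHom_ext fun ij => ?_
    rw [AlgHom.comp_apply, substLin, aeval_X, evalMat_linPoly, evalMat_X]
  exact DFunLike.congr_fun this p

/-- The differential of `p` at the identity matrix, as a linear form in the direction `Y`. -/
noncomputable def diffOne :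
    MvPolynomial (Fin n × Fin n) K →ₗ[K] Module.Dual K (Matrix (Fin n) (Fin n) K) where
  toFun p :=
    { toFun := fun Y => ∑ ij : Fin n × Fin n, evalMat 1 (pderiv ij p) * Y ij.1 ij.2
      map_add' := fun Y Z => by simp [mul_add, Finset.sum_add_distrib]
      map_smul' := fun a Y => by
        simp only [Matrix.smul_apply, smul_eq_mul, Finset.mul_sum, RingHom.id_apply]
        exact Finset.sum_congr rfl fun _ _ => by ring }
  map_add' p q := by ext1 Y; simp [add_mul, Finset.sum_add_distrib]
  map_smul' a p := by
    apply LinearMap.ext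
    intro Y
    simp only [LinearMap.coe_mk, AddHom.coe_mk, smul_eq_mul, Finset.mul_sum,
      RingHom.id_apply, LinearMap.smul_apply]
    refine Finset.sum_congr rfl fun ij _ => ?_
    rw [Derivation.map_smul, map_smul, smul_eq_mul, mul_assoc]

theorem diffOne_apply (p : MvPolynomial (Fin n × Fin n) K) (Y : Matrix (Fin n) (Fin n) K) :
    diffOne p Y = ∑ ij : Fin n × Fin n, evalMat 1 (pderiv ij p) * Y ij.1 ij.2 := rfl

theorem diffOne_mul (p q : MvPolynomial (Fin n × Fin n) K) (Y : Matrix (Fin n) (Fin n) K) :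
    diffOne (p * q) Y = evalMat 1 p * diffOne q Y + evalMat 1 q * diffOne p Y := by
  simp only [diffOne_apply, Finset.mul_sum, ← Finset.sum_add_distrib]
  refine Finset.sum_congr rfl fun ij _ => ?_
  rw [Derivation.leibniz]
  simp only [smul_eq_mul, map_add, map_mul]
  ring

theorem diffOne_C (a : K) : diffOne (C a : MvPolynomial (Fin n × Fin n) K) = 0 := by
  ext1 Y
  simp [diffOne_apply]

theorem diffOne_X (ij : Fin n × Fin n) (Y : Matrix (Fin n) (Fin n) K) :
    diffOne (X ij) Y = Y ij.1 ij.2 := by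
  rw [diffOne_apply, Finset.sum_eq_single ij]
  · simp
  · intro kl _ h
    rw [pderiv_X_of_ne h.symm]
    simp
  · simp

/-- The chain rule for a linear substitution that fixes the identity matrix. -/
theorem diffOne_substLin (L : Matrix (Fin n) (Fin n) K →ₗ[K] Matrix (Fin n) (Fin n) K)
    (hL : L 1 = 1) (p : MvPolynomial (Fin n × Fin n) K) (Y : Matrix (Fin n) (Fin n) K) :
    diffOne (substLin L p) Y = diffOne p (L Y) := by
  induction p using MvPolynomial.induction_on with
  | C a => simp [substLin, diffOne_C, MvPolynomial.algebraMap_eq]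
  | add p q hp hq => simp only [map_add, LinearMap.add_apply, hp, hq]
  | mul_X p ij hp =>
    rw [map_mul, diffOne_mul, diffOne_mul, hp, evalMat_substLin, evalMat_substLin, hL, diffOne_X]
    congr 2
    rw [substLin, aeval_X, linPoly, map_sum, LinearMap.sum_apply, ← sum_apply_single_mul]
    refine Finset.sum_congr rfl fun kl _ => ?_
    rw [diffOne_mul, diffOne_C, diffOne_X, evalMat_C]
    simp

/-- The ideal of polynomials vanishing at the identity matrix. -/
noncomputable def idealOne (n : ℕ) (K : Type*) [Field K] : Ideal (MvPolynomial (Fin n × Fin n) K) :=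
  RingHom.ker (evalMat (1 : Matrix (Fin n) (Fin n) K))

theorem mem_idealOne {p : MvPolynomial (Fin n × Fin n) K} :
    p ∈ idealOne n K ↔ evalMat 1 p = 0 := Iff.rfl

/-- The ideal of polynomials vanishing on `G`. -/
def vanishingIdeal (G : Subgroup (GL (Fin n) K)) : Ideal (MvPolynomial (Fin n × Fin n) K) where
  carrier := {p | ∀ g ∈ G, evalMat (g : Matrix (Fin n) (Fin n) K) p = 0}
  add_mem' hp hq g hg := by rw [map_add, hp g hg, hq g hg, add_zero]
  zero_mem' g _ := map_zero _
  smul_mem' c p hp g hg := by rw [smul_eq_mul, map_mul, hp g hg, mul_zero]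

/-- Taylor expansion to first order at the identity matrix. -/
theorem sub_taylor_mem_sq (p : MvPolynomial (Fin n × Fin n) K) :
    p - C (evalMat 1 p) - ∑ ij : Fin n × Fin n, C (evalMat 1 (pderiv ij p)) *
      (X ij - C ((1 : Matrix (Fin n) (Fin n) K) ij.1 ij.2)) ∈ idealOne n K ^ 2 := by
  have hX : ∀ ij : Fin n × Fin n,
      (X ij - C ((1 : Matrix (Fin n) (Fin n) K) ij.1 ij.2)) ∈ idealOne n K := fun ij => by
    rw [mem_idealOne]; simp
  induction p using MvPolynomial.induction_on with
  | C a => simp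
  | add p q hp hq =>
    convert Ideal.add_mem _ hp hq using 1
    simp only [map_add, add_mul, Finset.sum_add_distrib]
    ring
  | mul_X p kl hp =>
    set y := X kl - C ((1 : Matrix (Fin n) (Fin n) K) kl.1 kl.2) with hy
    set D := ∑ ij : Fin n × Fin n, C (evalMat 1 (pderiv ij p)) *
      (X ij - C ((1 : Matrix (Fin n) (Fin n) K) ij.1 ij.2)) with hD
    have hDm : D ∈ idealOne n K := Ideal.sum_mem _ fun ij _ => Ideal.mul_mem_left _ _ (hX ij)
    have h1 : ∑ ij : Fin n × Fin n, C (evalMat 1 (pderiv ij (p * X kl))) *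
        (X ij - C ((1 : Matrix (Fin n) (Fin n) K) ij.1 ij.2)) =
        C (evalMat 1 p) * y + C ((1 : Matrix (Fin n) (Fin n) K) kl.1 kl.2) * D := by
      have : ∀ ij : Fin n × Fin n, C (evalMat 1 (pderiv ij (p * X kl))) *
          (X ij - C ((1 : Matrix (Fin n) (Fin n) K) ij.1 ij.2)) =
          (if ij = kl then C (evalMat 1 p) * y else 0) +
          C ((1 : Matrix (Fin n) (Fin n) K) kl.1 kl.2) * (C (evalMat 1 (pderiv ij p)) *
            (X ij - C ((1 : Matrix (Fin n) (Fin n) K) ij.1 ij.2))) := by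
        intro ij
        rw [Derivation.leibniz]
        simp only [smul_eq_mul, map_add, map_mul, evalMat_X]
        rcases eq_or_ne ij kl with rfl | h
        · rw [if_pos rfl, pderiv_X_self, map_one, map_one, mul_one]
          ring
        · rw [if_neg h, pderiv_X_of_ne h.symm, map_zero, map_zero]
          ring
      simp only [this, Finset.sum_add_distrib, Finset.sum_ite_eq', Finset.mem_univ, if_true,
        ← Finset.mul_sum, hD]
    rw [h1]
    have h2 : p * X kl - C (evalMat 1 (p * X kl)) - (C (evalMat 1 p) * y +
        C ((1 : Matrix (Fin n) (Fin n) K) kl.1 kl.2) * D) =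
        X kl * (p - C (evalMat 1 p) - D) + D * y := by
      rw [map_mul, evalMat_X, map_mul, hy]
      ring
    rw [h2]
    refine Ideal.add_mem _ (Ideal.mul_mem_left _ _ hp) ?_
    rw [pow_two]
    exact Ideal.mul_mem_mul hDm (hX kl)

/-- The cotangent space of `G` at the identity is the dual of its Lie algebra: a polynomial
vanishing at the identity whose differential vanishes on the Lie algebra is, modulo the
polynomials vanishing on `G`, of order two. -/
theorem mem_sup_sq_of_diffOne_eq_zero (G : Subgroup (GL (Fin n) K))
    {p : MvPolynomial (Fin n × Fin n) K} (hp : p ∈ idealOne n K)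
    (hd : ∀ Y ∈ lieAlg G, diffOne p Y = 0) :
    p ∈ vanishingIdeal G ⊔ idealOne n K ^ 2 := by
  let D : Submodule K (Module.Dual K (Matrix (Fin n) (Fin n) K)) :=
    ((vanishingIdeal G).restrictScalars K).map diffOne
  have hD : D.dualCoannihilator ≤ lieAlg G := by
    intro Y hY q hq
    rw [Submodule.mem_dualCoannihilator] at hY
    have := hY (diffOne q) ⟨q, fun g hg => by rw [evalMat_eq]; exact hq g hg, rfl⟩
    rw [diffOne_apply] at this
    simpa only [evalMat_eq] using this
  have h1 : diffOne p ∈ D.dualCoannihilator.dualAnnihilator := by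
    rw [Submodule.mem_dualAnnihilator]
    exact fun Y hY => hd Y (hD hY)
  rw [Subspace.dualCoannihilator_dualAnnihilator_eq] at h1
  obtain ⟨q, hq, hqp⟩ := h1
  have h2 : p - q ∈ idealOne n K ^ 2 := by
    have h3 := sub_taylor_mem_sq (p - q)
    have hq1 : evalMat 1 q = 0 := by simpa using hq 1 G.one_mem
    have h4 : ∀ ij, evalMat 1 (pderiv ij (p - q)) = 0 := by
      intro ij
      have h5 : diffOne (p - q) (Matrix.single ij.1 ij.2 1) = 0 := by
        rw [map_sub, hqp, sub_self, LinearMap.zero_apply]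
      rw [diffOne_apply, Finset.sum_eq_single ij] at h5
      · simpa using h5
      · intro kl _ hkl
        rw [Matrix.single_apply_of_ne _ _ _ _ _ (fun h => hkl (Prod.ext h.1.symm h.2.symm)),
          mul_zero]
      · simp
    have h6 : evalMat 1 (p - q) = 0 := by rw [map_sub, mem_idealOne.mp hp, hq1, sub_zero]
    simpa only [h4, h6, map_zero, sub_zero, zero_mul, Finset.sum_const_zero] using h3
  rw [← sub_add_cancel p q, add_comm]
  exact Submodule.add_mem_sup hq h2

/-! ### Elements acting trivially on the Lie algebra -/

theorem mul_mem_sup_pow {R : Type*} [CommRing R] {I m : Ideal R} {j k : ℕ} {f g : R}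
    (hf : f ∈ I ⊔ m ^ j) (hg : g ∈ m ^ k) : f * g ∈ I ⊔ m ^ (j + k) := by
  obtain ⟨i, hi, q, hq, rfl⟩ := Submodule.mem_sup.mp hf
  rw [add_mul]
  refine Submodule.add_mem_sup (I.mul_mem_right g hi) ?_
  rw [pow_add]
  exact Ideal.mul_mem_mul hq hg

theorem substLin_conjLin_mem_vanishingIdeal {G : Subgroup (GL (Fin n) K)} {t : GL (Fin n) K}
    (ht : t ∈ G) {p : MvPolynomial (Fin n × Fin n) K} (hp : p ∈ vanishingIdeal G) :
    substLin (conjLin t) p ∈ vanishingIdeal G := by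
  intro g hg
  rw [evalMat_substLin, conjLin_coe]
  exact hp _ (G.mul_mem (G.mul_mem ht hg) (G.inv_mem ht))

theorem conjLin_apply_one (t : GL (Fin n) K) : conjLin t 1 = 1 := by
  simp [conjLin_apply]

/-- The Lie algebra of `G` is stable under the adjoint action of `G`. -/
theorem conjLin_mem_lieAlg {G : Subgroup (GL (Fin n) K)} {t : GL (Fin n) K}
    (ht : t ∈ G) {Y : Matrix (Fin n) (Fin n) K} (hY : Y ∈ lieAlg G) :
    conjLin t Y ∈ lieAlg G := by
  intro p hp
  have hp' : p ∈ vanishingIdeal G := fun g hg => by rw [evalMat_eq]; exact hp g hg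
  have h := hY (substLin (conjLin t) p) fun g hg => by
    rw [← evalMat_eq]; exact substLin_conjLin_mem_vanishingIdeal ht hp' g hg
  simp only [← evalMat_eq] at h ⊢
  rw [← diffOne_apply] at h ⊢
  rwa [diffOne_substLin _ (conjLin_apply_one t)] at h

/-- If `t` acts trivially on the Lie algebra of `G`, then it acts trivially on all successive
quotients of the powers of the maximal ideal at the identity. -/
theorem substLin_conjLin_sub_mem {G : Subgroup (GL (Fin n) K)} {t : GL (Fin n) K}
    (htriv : ∀ Y ∈ lieAlg G, conjLin t Y = Y) (k : ℕ)
    {p : MvPolynomial (Fin n × Fin n) K} (hp : p ∈ idealOne n K ^ k) :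
    substLin (conjLin t) p - p ∈ vanishingIdeal G ⊔ idealOne n K ^ (k + 1) := by
  have hm : ∀ q, q ∈ idealOne n K → substLin (conjLin t) q ∈ idealOne n K := by
    intro q hq
    rw [mem_idealOne] at hq ⊢
    rw [evalMat_substLin, conjLin_apply_one, hq]
  induction k generalizing p with
  | zero =>
    refine Ideal.mem_sup_right ?_
    rw [zero_add, pow_one, mem_idealOne, map_sub, evalMat_substLin, conjLin_apply_one, sub_self]
  | succ k ih =>
    rw [pow_succ'] at hp
    refine Submodule.mul_induction_on hp (fun f hf g hg => ?_) (fun x y hx hy => ?_)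
    · have h1 : substLin (conjLin t) f - f ∈ vanishingIdeal G ⊔ idealOne n K ^ 2 := by
        refine mem_sup_sq_of_diffOne_eq_zero G (Ideal.sub_mem _ (hm f hf) hf) fun Y hY => ?_
        rw [map_sub, LinearMap.sub_apply, diffOne_substLin _ (conjLin_apply_one t), htriv Y hY,
          sub_self]
      have h2 := ih hg
      have h3 : substLin (conjLin t) (f * g) - f * g =
          substLin (conjLin t) f * (substLin (conjLin t) g - g) +
            (substLin (conjLin t) f - f) * g := by
        rw [map_mul]; ring
      rw [h3]
      refine Ideal.add_mem _ ?_ ?_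
      · rw [mul_comm]
        exact mul_mem_sup_pow h2 (by rw [pow_one]; exact hm f hf)
      · have h4 := mul_mem_sup_pow h1 hg
        rwa [show 2 + k = k + 1 + 1 by ring] at h4
    · have h1 : substLin (conjLin t) (x + y) - (x + y) =
          (substLin (conjLin t) x - x) + (substLin (conjLin t) y - y) := by
        rw [map_add]; ring
      rw [h1]
      exact Ideal.add_mem _ hx hy

/-- If `t ∈ G` acts trivially on the Lie algebra of `G`, a function on `G` that is an eigenvector
of conjugation by `t` with an eigenvalue other than `1` vanishes to infinite order at the identity,
so it vanishes on a neighbourhood of the identity by Krull's intersection theorem. -/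
theorem exists_mul_mem_vanishingIdeal {G : Subgroup (GL (Fin n) K)} {t : GL (Fin n) K}
    (ht : t ∈ G) (htriv : ∀ Y ∈ lieAlg G, conjLin t Y = Y) {c : K} (hc : c ≠ 1)
    {f : MvPolynomial (Fin n × Fin n) K}
    (hf : substLin (conjLin t) f - C c * f ∈ vanishingIdeal G) :
    ∃ u : MvPolynomial (Fin n × Fin n) K, evalMat 1 u ≠ 0 ∧ u * f ∈ vanishingIdeal G := by
  have hmem : ∀ k, f ∈ vanishingIdeal G ⊔ idealOne n K ^ k := by
    intro k
    induction k with
    | zero => simp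
    | succ k ih =>
      obtain ⟨i, hi, q, hq, rfl⟩ := Submodule.mem_sup.mp ih
      have h1 := substLin_conjLin_sub_mem htriv k hq
      have h2 : C (c - 1) * (i + q) = (substLin (conjLin t) q - q) +
          (substLin (conjLin t) i - i - (substLin (conjLin t) (i + q) - C c * (i + q))) := by
        rw [map_add, C_sub, C_1]; ring
      have h3 : C (c - 1) * (i + q) ∈ vanishingIdeal G ⊔ idealOne n K ^ (k + 1) := by
        rw [h2]
        refine Ideal.add_mem _ h1 (Ideal.mem_sup_left (Ideal.sub_mem _ (Ideal.sub_mem _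
          (substLin_conjLin_mem_vanishingIdeal ht hi) hi) hf))
      have h4 : i + q = C (c - 1)⁻¹ * (C (c - 1) * (i + q)) := by
        rw [← mul_assoc, ← C_mul, inv_mul_cancel₀ (sub_ne_zero.mpr hc), C_1, one_mul]
      rw [h4]
      exact Ideal.mul_mem_left _ _ h3
  have h1 : (Submodule.Quotient.mk f : MvPolynomial (Fin n × Fin n) K ⧸ vanishingIdeal G) ∈
      (⨅ k : ℕ, idealOne n K ^ k • ⊤ : Submodule (MvPolynomial (Fin n × Fin n) K) _) := by
    rw [Submodule.mem_iInf]
    intro k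
    obtain ⟨i, hi, q, hq, hiq⟩ := Submodule.mem_sup.mp (hmem k)
    have h2 : (Submodule.Quotient.mk f : MvPolynomial (Fin n × Fin n) K ⧸ vanishingIdeal G) =
        q • Submodule.Quotient.mk 1 := by
      rw [← Submodule.Quotient.mk_smul, smul_eq_mul, mul_one, Submodule.Quotient.eq, ← hiq,
        add_sub_cancel_right]
      exact hi
    rw [h2]
    exact Submodule.smul_mem_smul hq Submodule.mem_top
  rw [Ideal.mem_iInf_smul_pow_eq_bot_iff] at h1
  obtain ⟨⟨r, hr⟩, h⟩ := h1
  refine ⟨1 - r, ?_, ?_⟩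
  · rw [map_sub, map_one, mem_idealOne.mp hr, sub_zero]
    exact one_ne_zero
  · rw [sub_mul, one_mul]
    rw [← Submodule.Quotient.mk_smul, Submodule.Quotient.eq, smul_eq_mul] at h
    rw [← neg_mem_iff, neg_sub]
    exact h

end Polynomials

/-! ### The Zariski topology -/

section Zariski

open MvPolynomial

variable {K : Type*} [Field K] {n : ℕ}

attribute [local instance] zariski

theorem isOpen_evalMat_ne_zero (p : MvPolynomial (Fin n × Fin n) K) :
    IsOpen {g : GL (Fin n) K | evalMat (g : Matrix (Fin n) (Fin n) K) p ≠ 0} := by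
  refine TopologicalSpace.isOpen_generateFrom_of_mem ⟨p, ?_⟩
  simp only [evalMat_eq]

theorem isClosed_evalMat_eq_zero (p : MvPolynomial (Fin n × Fin n) K) :
    IsClosed {g : GL (Fin n) K | evalMat (g : Matrix (Fin n) (Fin n) K) p = 0} :=
  ⟨isOpen_evalMat_ne_zero p⟩

/-- The principal open sets form a basis of the Zariski topology. -/
theorem exists_evalMat_ne_zero_subset {U : Set (GL (Fin n) K)} (hU : IsOpen U) {g : GL (Fin n) K}
    (hg : g ∈ U) : ∃ p : MvPolynomial (Fin n × Fin n) K,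
      evalMat (g : Matrix (Fin n) (Fin n) K) p ≠ 0 ∧
      ∀ h : GL (Fin n) K, evalMat (h : Matrix (Fin n) (Fin n) K) p ≠ 0 → h ∈ U := by
  induction hU with
  | basic s hs =>
    obtain ⟨p, rfl⟩ := hs
    refine ⟨p, ?_, fun h hh => ?_⟩
    · rw [evalMat_eq]; exact hg
    · rw [evalMat_eq] at hh; exact hh
  | univ => exact ⟨1, by simp, fun _ _ => trivial⟩
  | inter s t _ _ hs ht =>
    obtain ⟨p, hp, hps⟩ := hs hg.1
    obtain ⟨q, hq, hqt⟩ := ht hg.2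
    refine ⟨p * q, by rw [map_mul]; exact mul_ne_zero hp hq, fun h hh => ?_⟩
    rw [map_mul] at hh
    exact ⟨hps h (left_ne_zero_of_mul hh), hqt h (right_ne_zero_of_mul hh)⟩
  | sUnion 𝒮 _ ih =>
    obtain ⟨s, hs, hgs⟩ := hg
    obtain ⟨p, hp, hps⟩ := ih s hs hgs
    exact ⟨p, hp, fun h hh => ⟨s, hs, hps h hh⟩⟩

theorem separatelyContinuousMul_zariski : SeparatelyContinuousMul (GL (Fin n) K) where
  continuous_const_mul {a} := by
    refine continuous_generateFrom_iff.mpr ?_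
    rintro _ ⟨p, rfl⟩
    convert isOpen_evalMat_ne_zero
      (substLin (LinearMap.mulLeft K (a : Matrix (Fin n) (Fin n) K)) p) using 1
    ext g
    simp [← evalMat_eq, evalMat_substLin]
  continuous_mul_const {a} := by
    refine continuous_generateFrom_iff.mpr ?_
    rintro _ ⟨p, rfl⟩
    convert isOpen_evalMat_ne_zero
      (substLin (LinearMap.mulRight K (a : Matrix (Fin n) (Fin n) K)) p) using 1
    ext g
    simp [← evalMat_eq, evalMat_substLin]

/-- A polynomial in the entries of `g⁻¹` becomes a polynomial in the entries of `g` on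
multiplication by a power of the determinant. -/
theorem exists_evalMat_inv (p : MvPolynomial (Fin n × Fin n) K) :
    ∃ (q : MvPolynomial (Fin n × Fin n) K) (N : ℕ), ∀ g : GL (Fin n) K,
      evalMat ((g⁻¹ : GL (Fin n) K) : Matrix (Fin n) (Fin n) K) p *
        (g : Matrix (Fin n) (Fin n) K).det ^ N = evalMat (g : Matrix (Fin n) (Fin n) K) q := by
  let Y : Matrix (Fin n) (Fin n) (MvPolynomial (Fin n × Fin n) K) := Matrix.of fun i j => X (i, j)
  have hY : ∀ g : Matrix (Fin n) (Fin n) K, (evalMat g).toRingHom.mapMatrix Y = g := by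
    intro g; ext i j; simp [Y]
  have hdet : ∀ g : Matrix (Fin n) (Fin n) K, evalMat g Y.det = g.det := by
    intro g
    have := RingHom.map_det (evalMat g).toRingHom Y
    rwa [hY] at this
  have hadj : ∀ (g : Matrix (Fin n) (Fin n) K) i j,
      evalMat g (Y.adjugate i j) = g.adjugate i j := by
    intro g i j
    have := congrFun (congrFun (RingHom.map_adjugate (evalMat g).toRingHom Y) i) j
    rwa [hY] at this
  induction p using MvPolynomial.induction_on with
  | C a => exact ⟨C a, 0, by simp⟩
  | add p q hp hq =>
    obtain ⟨p', N, hp⟩ := hp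
    obtain ⟨q', N', hq⟩ := hq
    refine ⟨p' * Y.det ^ N' + q' * Y.det ^ N, N + N', fun g => ?_⟩
    rw [map_add, map_add, map_mul, map_mul, map_pow, map_pow, ← hp, ← hq, hdet]
    ring
  | mul_X p ij hp =>
    obtain ⟨p', N, hp⟩ := hp
    refine ⟨p' * Y.adjugate ij.1 ij.2, N + 1, fun g => ?_⟩
    have h1 : (g : Matrix (Fin n) (Fin n) K).det ≠ 0 :=
      ((Matrix.isUnit_iff_isUnit_det _).mp g.isUnit).ne_zero
    rw [map_mul, map_mul, ← hp, hadj, evalMat_X, Matrix.coe_units_inv, Matrix.inv_def,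
      Matrix.smul_apply, smul_eq_mul, Ring.inverse_eq_inv', pow_succ]
    field_simp

theorem continuousInv_zariski : ContinuousInv (GL (Fin n) K) where
  continuous_inv := by
    refine continuous_generateFrom_iff.mpr ?_
    rintro _ ⟨p, rfl⟩
    obtain ⟨q, N, hq⟩ := exists_evalMat_inv p
    convert isOpen_evalMat_ne_zero q using 1
    ext g
    have h1 : (g : Matrix (Fin n) (Fin n) K).det ≠ 0 :=
      ((Matrix.isUnit_iff_isUnit_det _).mp g.isUnit).ne_zero
    simp only [Set.mem_preimage, Set.mem_ofPred_eq, ← evalMat_eq, ← hq]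
    simp [h1]

theorem isClosed_commute (a : GL (Fin n) K) : IsClosed {g : GL (Fin n) K | a * g = g * a} := by
  let L := LinearMap.mulLeft K (a : Matrix (Fin n) (Fin n) K) -
    LinearMap.mulRight K (a : Matrix (Fin n) (Fin n) K)
  have : {g : GL (Fin n) K | a * g = g * a} =
      ⋂ ij : Fin n × Fin n, {g : GL (Fin n) K |
        evalMat (g : Matrix (Fin n) (Fin n) K) (linPoly L ij) = 0} := by
    ext g
    simp only [Set.mem_ofPred_eq, Set.mem_iInter, evalMat_linPoly, L, LinearMap.sub_apply,
      Matrix.sub_apply, sub_eq_zero, LinearMap.mulLeft_apply, LinearMap.mulRight_apply]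
    constructor
    · intro h ij
      rw [← Units.val_mul, h, Units.val_mul]
    · intro h
      exact Units.ext (Matrix.ext fun i j => h (i, j))
  rw [this]
  exact isClosed_iInter fun ij => isClosed_evalMat_eq_zero _

/-- A subgroup that contains a neighbourhood of the identity in a connected group contains the
group. -/
theorem le_of_isPreconnected {H : Type*} [Group H] [TopologicalSpace H] [SeparatelyContinuousMul H]
    {G C : Subgroup H} (hG : IsPreconnected (G : Set H)) {O : Set H} (hO : IsOpen O)
    (h1 : (1 : H) ∈ O) (hOC : ∀ g ∈ G, g ∈ O → g ∈ C) : G ≤ C := by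
  intro g hg
  by_contra hgC
  -- translates of `O` by `s`; those by `G ∩ C` and by `G \ C` would disconnect `G`
  let A : Set H → Set H := fun s => {h | ∃ a ∈ s, a⁻¹ * h ∈ O}
  have hA : ∀ s, IsOpen (A s) := by
    intro s
    have : A s = ⋃ a ∈ s, (fun h => a⁻¹ * h) ⁻¹' O := by ext; simp [A]
    rw [this]
    exact isOpen_biUnion fun a _ => hO.preimage (continuous_const_mul a⁻¹)
  have hsub : ∀ {s : Set H} {x}, x ∈ s → x ∈ A s := fun {s x} hx => ⟨x, hx, by simpa using h1⟩
  obtain ⟨x, hx, ⟨a, ha, hax⟩, ⟨b, hb, hbx⟩⟩ := hG _ _ (hA {h | h ∈ G ∧ h ∈ C})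
    (hA {h | h ∈ G ∧ h ∉ C})
    (fun x hx => by
      by_cases hxC : x ∈ C
      · exact Or.inl (hsub ⟨hx, hxC⟩)
      · exact Or.inr (hsub ⟨hx, hxC⟩))
    ⟨1, G.one_mem, hsub ⟨G.one_mem, C.one_mem⟩⟩ ⟨g, hg, hsub ⟨hg, hgC⟩⟩
  have h2 := hOC _ (G.mul_mem (G.inv_mem ha.1) hx) hax
  have h3 := hOC _ (G.mul_mem (G.inv_mem hb.1) hx) hbx
  apply hb.2
  have h4 : b = a * (a⁻¹ * x) * (b⁻¹ * x)⁻¹ := by group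
  rw [h4]
  exact C.mul_mem (C.mul_mem ha.2 h2) (C.inv_mem h3)

variable {G T : Subgroup (GL (Fin n) K)}

/-- An element of a torus in the connected group `G` that acts trivially on the Lie algebra of `G`
centralizes `G`. -/
theorem commute_of_trivial_on_lieAlg [Infinite K] (hG : IsConn G) (hT : IsTorus T) (hTG : T ≤ G)
    (t : T) (htriv : ∀ Y ∈ lieAlg G, conjLin (t : GL (Fin n) K) Y = Y) {g : GL (Fin n) K}
    (hg : g ∈ G) : (t : GL (Fin n) K) * g = g * t := by
  obtain ⟨S, π, h1, -, h3⟩ := hT.exists_weight_projections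
  have hu : ∀ (χ : CharLattice T) (ij : Fin n × Fin n), ∃ u : MvPolynomial (Fin n × Fin n) K,
      evalMat 1 u ≠ 0 ∧ (χ ∈ S → (charEval χ t : K) ≠ 1 →
        u * linPoly (π χ) ij ∈ vanishingIdeal G) := by
    intro χ ij
    by_cases h : χ ∈ S ∧ (charEval χ t : K) ≠ 1
    · obtain ⟨u, hu1, hu2⟩ := exists_mul_mem_vanishingIdeal (hTG t.2) htriv h.2
        (f := linPoly (π χ) ij) (by
          intro g _
          rw [map_sub, map_mul, evalMat_substLin, evalMat_linPoly, evalMat_linPoly, evalMat_C,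
            h3 χ h.1, Matrix.smul_apply, smul_eq_mul, sub_self])
      exact ⟨u, hu1, fun _ _ => hu2⟩
    · exact ⟨1, by simp, fun h4 h5 => (h ⟨h4, h5⟩).elim⟩
  choose u hu1 hu2 using hu
  -- where `U` does not vanish, all components of `g` of weight nontrivial at `t` are zero
  let U := ∏ χ ∈ S, ∏ ij : Fin n × Fin n, u χ ij
  have hU1 : evalMat 1 U ≠ 0 := by
    simp only [U, map_prod]
    exact Finset.prod_ne_zero_iff.mpr fun χ _ => Finset.prod_ne_zero_iff.mpr fun ij _ => hu1 χ ij
  have := separatelyContinuousMul_zariski (n := n) (K := K)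
  suffices h : G ≤ Subgroup.centralizer {(t : GL (Fin n) K)} by
    exact (Subgroup.mem_centralizer_iff.mp (h hg)) _ rfl
  refine le_of_isPreconnected hG.isPreconnected (isOpen_evalMat_ne_zero U)
    (by simpa using hU1) fun g hg hgU => ?_
  have h4 : ∀ χ ∈ S, (charEval χ t : K) • π χ (g : Matrix (Fin n) (Fin n) K) =
      π χ (g : Matrix (Fin n) (Fin n) K) := by
    intro χ hχ
    by_cases h5 : (charEval χ t : K) = 1
    · rw [h5, one_smul]
    · have h6 : π χ (g : Matrix (Fin n) (Fin n) K) = 0 := by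
        ext i j
        have h7 := hu2 χ (i, j) hχ h5 g hg
        rw [map_mul, evalMat_linPoly] at h7
        refine (mul_eq_zero.mp h7).resolve_left fun h8 => hgU ?_
        simp only [U, map_prod]
        exact Finset.prod_eq_zero hχ (Finset.prod_eq_zero (Finset.mem_univ (i, j)) h8)
      rw [h6, smul_zero]
  have h5 : conjLin (t : GL (Fin n) K) (g : Matrix (Fin n) (Fin n) K) = g := by
    rw [h1, Finset.sum_congr rfl h4]
    have h6 := h1 1 (g : Matrix (Fin n) (Fin n) K)
    rw [Subgroup.coe_one, conjLin_one] at h6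
    simpa [charEval_one] using h6.symm
  rw [conjLin_coe] at h5
  rw [Subgroup.mem_centralizer_iff]
  rintro _ rfl
  exact mul_inv_eq_iff_eq_mul.mp (Units.ext h5)

/-- The restriction of a polynomial to a one-parameter subgroup of a torus is a Laurent
polynomial. -/
theorem exists_polynomial_eq_evalMat [Infinite K] (hT : IsTorus T)
    (g : Module.Dual ℤ (CharLattice T)) (l : Kˣ →* T) (hl : ∀ z χ, charEval χ (l z) = z ^ g χ)
    (p : MvPolynomial (Fin n × Fin n) K) :
    ∃ (P : Polynomial K) (N : ℕ), ∀ z : Kˣ,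
      evalMat ((l z : GL (Fin n) K) : Matrix (Fin n) (Fin n) K) p * (z : K) ^ N =
        P.eval (z : K) := by
  have hmem : (fun t : T => evalMat ((t : GL (Fin n) K) : Matrix (Fin n) (Fin n) K) p) ∈
      coordRing T := by
    induction p using MvPolynomial.induction_on with
    | C a =>
      convert (coordRing T).algebraMap_mem a using 1
      funext t
      simp
    | add p q hp hq =>
      convert (coordRing T).add_mem hp hq using 1
      funext t
      simp
    | mul_X p ij hp =>
      convert (coordRing T).mul_mem hp (Algebra.subset_adjoin (Or.inl ⟨ij, rfl⟩)) using 1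
      funext t
      simp
  obtain ⟨c, hc⟩ := Finsupp.mem_span_range_iff_exists_finsupp.mp (hT.exists_basis.2 _ hmem)
  -- large enough to clear the negative exponents
  let N : ℕ := ∑ χ ∈ c.support, (g χ).natAbs
  refine ⟨∑ χ ∈ c.support, Polynomial.C (c χ) * Polynomial.X ^ (g χ + N).toNat, N, fun z => ?_⟩
  have h1 := congrFun hc (l z)
  simp only [Finsupp.sum, Finset.sum_apply, Pi.smul_apply, smul_eq_mul, hl] at h1
  rw [← h1, Finset.sum_mul, Polynomial.eval_finsetSum]
  refine Finset.sum_congr rfl fun χ hχ => ?_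
  have h2 : (g χ).natAbs ≤ N :=
    Finset.single_le_sum (f := fun χ => (g χ).natAbs) (fun _ _ => Nat.zero_le _) hχ
  have h3 : z ^ (g χ + N).toNat = z ^ g χ * z ^ N := by
    rw [← zpow_natCast, ← zpow_natCast, Int.toNat_of_nonneg (by omega), _root_.zpow_add]
  rw [Polynomial.eval_mul, Polynomial.eval_C, Polynomial.eval_pow, Polynomial.eval_X, mul_assoc]
  congr 1
  exact_mod_cast (congrArg (Units.val) h3).symm

/-- The image of a one-parameter subgroup is irreducible: a nonzero Laurent polynomial vanishes at
only finitely many points of the infinite field `K`. -/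
theorem isPreconnected_range_cocharacter [Infinite K] (hT : IsTorus T)
    (g : Module.Dual ℤ (CharLattice T)) (l : Kˣ →* T) (hl : ∀ z χ, charEval χ (l z) = z ^ g χ) :
    IsPreconnected (Set.range fun z => (l z : GL (Fin n) K)) := by
  apply IsPreirreducible.isPreconnected
  rintro U V hU hV ⟨_, ⟨z, rfl⟩, hz⟩ ⟨_, ⟨w, rfl⟩, hw⟩
  obtain ⟨p, hp, hpU⟩ := exists_evalMat_ne_zero_subset hU hz
  obtain ⟨q, hq, hqV⟩ := exists_evalMat_ne_zero_subset hV hw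
  obtain ⟨P, N, hP⟩ := exists_polynomial_eq_evalMat hT g l hl p
  obtain ⟨Q, N', hQ⟩ := exists_polynomial_eq_evalMat hT g l hl q
  have hP0 : P ≠ 0 := by
    rintro rfl
    have h := hP z
    rw [Polynomial.eval_zero] at h
    exact mul_ne_zero hp (pow_ne_zero _ z.ne_zero) h
  have hQ0 : Q ≠ 0 := by
    rintro rfl
    have h := hQ w
    rw [Polynomial.eval_zero] at h
    exact mul_ne_zero hq (pow_ne_zero _ w.ne_zero) h
  obtain ⟨x, hx⟩ : ∃ x, (P * Q * Polynomial.X).eval x ≠ 0 := by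
    by_contra! h
    exact mul_ne_zero (mul_ne_zero hP0 hQ0) Polynomial.X_ne_zero
      (Polynomial.funext fun x => by rw [h x, Polynomial.eval_zero])
  rw [Polynomial.eval_mul, Polynomial.eval_mul, Polynomial.eval_X] at hx
  have hx0 : x ≠ 0 := right_ne_zero_of_mul hx
  refine ⟨l (Units.mk0 x hx0), ⟨_, rfl⟩, hpU _ ?_, hqV _ ?_⟩
  · have h := hP (Units.mk0 x hx0)
    intro h0
    rw [h0, zero_mul] at h
    exact left_ne_zero_of_mul (left_ne_zero_of_mul hx) h.symm
  · have h := hQ (Units.mk0 x hx0)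
    intro h0
    rw [h0, zero_mul] at h
    exact right_ne_zero_of_mul (left_ne_zero_of_mul hx) h.symm

/-- A central one-parameter subgroup of a semisimple group is trivial: its closure is a closed
connected central subgroup. -/
theorem cocharacter_eq_one [Infinite K] (hG : IsConnectedSemisimple G) (hT : IsTorus T)
    (hTG : T ≤ G) (g : Module.Dual ℤ (CharLattice T)) (l : Kˣ →* T)
    (hl : ∀ z χ, charEval χ (l z) = z ^ g χ)
    (hcomm : ∀ z, ∀ x ∈ G, (l z : GL (Fin n) K) * x = x * l z) (z : Kˣ) : l z = 1 := by
  have := separatelyContinuousMul_zariski (n := n) (K := K)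
  have := continuousInv_zariski (n := n) (K := K)
  let S : Subgroup (GL (Fin n) K) := (T.subtype.comp l).range
  let H : Subgroup (GL (Fin n) K) :=
    { S.toSubmonoid.topologicalClosure with
      inv_mem' := fun {x} hx =>
        map_mem_closure continuous_inv hx fun y hy => S.inv_mem hy }
  have hH : (H : Set (GL (Fin n) K)) = closure (S : Set (GL (Fin n) K)) := rfl
  have hS : (S : Set (GL (Fin n) K)) = Set.range fun z => (l z : GL (Fin n) K) := rfl
  have hHG : H ≤ G := by
    intro x hx
    refine closure_minimal (s := (S : Set (GL (Fin n) K))) ?_ hG.algebraic hx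
    rintro _ ⟨z, rfl⟩
    exact hTG (l z).2
  have hHcomm : ∀ x ∈ G, ∀ h ∈ H, x * h = h * x := by
    intro x hx h hh
    refine closure_minimal (s := (S : Set (GL (Fin n) K))) ?_ (isClosed_commute x) hh
    rintro _ ⟨z, rfl⟩
    exact (hcomm z x hx).symm
  have hbot : H = ⊥ := by
    refine hG.radical_trivial H hHG ?_ ?_ ?_ ?_
    · exact isClosed_closure
    · refine ⟨⟨1, H.one_mem⟩, ?_⟩
      rw [hH, hS]
      exact (isPreconnected_range_cocharacter hT g l hl).closure
    · refine ⟨fun h hh x => ?_⟩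
      rw [Subgroup.mem_subgroupOf] at hh ⊢
      have h1 := hHcomm x x.2 h hh
      rw [Subgroup.coe_mul, Subgroup.coe_mul, h1, Subgroup.coe_inv, mul_inv_cancel_right]
      exact hh
    · exact Group.isSolvable_of_comm fun a b => Subtype.ext (hHcomm a (hHG a.2) b b.2)
  have hz : (l z : GL (Fin n) K) ∈ H := subset_closure ⟨z, rfl⟩
  rw [hbot, Subgroup.mem_bot] at hz
  exact Subtype.ext hz

end Zariski

/-! ### The roots of a semisimple group -/

section Roots

open Module

variable {K : Type*} [Field K] {n : ℕ} {G T : Subgroup (GL (Fin n) K)}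

/-- The roots are among the weights of the torus on all matrices. -/
theorem finite_roots [Infinite K] (hT : IsTorus T) : (roots G T).Finite := by
  obtain ⟨S, π, h1, -, -⟩ := hT.exists_weight_projections
  refine S.finite_toSet.subset ?_
  rintro α ⟨-, X, -, hX0, hX⟩
  by_contra hα
  classical
  -- the coefficient of `α` in `t X t⁻¹` is `X` by hypothesis, and `0` since `α ∉ S`
  refine hX0 ?_
  have h2 := eq_of_sum_charEval_smul_eq (S := insert α S)
    (u := fun χ => if χ = α then X else 0) (v := fun χ => if χ = α then 0 else π χ X) (fun t => by
      rw [Finset.sum_insert hα, Finset.sum_insert hα, if_pos rfl, if_pos rfl, smul_zero, zero_add,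
        Finset.sum_eq_zero, add_zero, ← hX t, ← conjLin_apply, h1]
      · refine Finset.sum_congr rfl fun χ hχ => ?_
        rw [if_neg (by rintro rfl; exact hα hχ)]
      · intro χ hχ
        rw [if_neg (by rintro rfl; exact hα hχ), smul_zero]) α (Finset.mem_insert_self _ _)
  simpa using h2

/-- Semisimplicity implies that the roots span a subgroup of finite index in the character
lattice: an additive functional that kills the roots comes from a one-parameter subgroup acting
trivially on the Lie algebra, hence central. -/
theorem dual_eq_zero_of_roots [Infinite K] (hG : IsConnectedSemisimple G) (hT : IsTorus T)
    (hTG : T ≤ G) (g : Dual ℤ (CharLattice T)) (hg : ∀ β ∈ roots G T, g β = 0) : g = 0 := by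
  obtain ⟨l, hl⟩ := hT.exists_cocharacter g
  obtain ⟨S, π, h1, h2, -⟩ := hT.exists_weight_projections
  -- the Lie algebra is stable under the weight projections
  have hπ : ∀ X ∈ lieAlg G, ∀ χ ∈ S, π χ X ∈ lieAlg G := by
    intro X hX χ hχ
    rw [← Subspace.forall_mem_dualAnnihilator_apply_eq_zero_iff]
    intro φ hφ
    refine eq_zero_of_sum_charEval (u := fun χ => φ (π χ X)) (fun t => ?_) χ hχ
    have h3 := (Submodule.mem_dualAnnihilator φ).mp hφ _ (conjLin_mem_lieAlg (hTG t.2) hX)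
    rw [h1, map_sum] at h3
    simpa [mul_comm] using h3
  have htriv : ∀ z, ∀ X ∈ lieAlg G, conjLin (l z : GL (Fin n) K) X = X := by
    intro z X hX
    have h3 := h1 1 X
    rw [Subgroup.coe_one, conjLin_one] at h3
    conv_rhs => rw [h3]
    rw [h1]
    refine Finset.sum_congr rfl fun χ hχ => ?_
    rw [charEval_one, hl]
    by_cases hX0 : π χ X = 0
    · rw [hX0, smul_zero, smul_zero]
    by_cases hχ0 : χ = 0
    · rw [hχ0, map_zero, zpow_zero]
    · rw [hg χ ⟨hχ0, π χ X, hπ X hX χ hχ, hX0, fun t => h2 χ hχ t X⟩, zpow_zero]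
  have hone := cocharacter_eq_one hG hT hTG g l hl fun z x hx =>
    commute_of_trivial_on_lieAlg hG.connected hT hTG (l z) (htriv z) hx
  refine LinearMap.ext fun χ => ?_
  by_contra hχ
  have hfin := finite_zpow_eq_one (K := K) hχ
  have hinf : Infinite Kˣ := infinite_units
  refine hinf.not_finite (Finite.of_injective
    (fun z : Kˣ => (⟨z, ?_⟩ : {x : Kˣ // x ^ g χ = 1})) fun z w h => congrArg Subtype.val h)
  rw [← hl, hone, charEval_one]

end Roots

/-! ### The Cartan matrix and Coxeter elements -/

section Cartan

open Module

/-- The Cartan matrix of linearly independent members `α i` of a finite set `Φ`, with coroots `f i`,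
has positive determinant if no nonzero functional kills all `α i`. It is the determinant of `1 - w`
for a Coxeter element `w`; since `w` belongs to a finite group, this is nonnegative, and it is not
zero because the reflections have no common nonzero fixed vector. -/
theorem det_pairing_pos {ι M : Type*} [Fintype ι] [DecidableEq ι] [AddCommGroup M]
    (b : Basis ι ℤ M) {Φ : Set M} (hΦ : Φ.Finite) (α : ι → M) (hmem : ∀ i, α i ∈ Φ)
    (hα : LinearIndependent ℤ α) (hspan : ∀ g : Dual ℤ M, (∀ i, g (α i) = 0) → g = 0)
    (f : ι → Dual ℤ M) (hf : ∀ i, IsCoroot Φ (α i) (f i)) :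
    0 < (Matrix.of fun i j => f j (α i)).det := by
  have : Module.Free ℤ M := Module.Free.of_basis b
  let W : Subgroup (M ≃ₗ[ℤ] M) :=
    Subgroup.closure (Set.range fun i => Module.reflection (hf i).1)
  have hWΦ : ∀ g ∈ W, Set.MapsTo g Φ Φ := by
    intro g hg
    have h : Set.MapsTo g Φ Φ ∧ Set.MapsTo (g⁻¹ : M ≃ₗ[ℤ] M) Φ Φ := by
      induction hg using Subgroup.closure_induction with
      | mem g hg =>
        obtain ⟨i, rfl⟩ := hg
        have h1 : Set.MapsTo (Module.reflection (hf i).1) Φ Φ := (hf i).2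
        refine ⟨h1, ?_⟩
        rw [Module.reflection_inv]
        exact h1
      | one => exact ⟨fun _ h => h, fun _ h => h⟩
      | mul g h _ _ hg hh =>
        refine ⟨hg.1.comp hh.1, ?_⟩
        rw [_root_.mul_inv_rev]
        exact hh.2.comp hg.2
      | inv g _ hg =>
        rw [inv_inv]
        exact ⟨hg.2, hg.1⟩
    exact h.1
  -- an element of `W` is determined by the images of the `α i`, which lie in the finite set `Φ`
  have : Finite Φ := hΦ
  have hfin : Finite W := by
    refine Finite.of_injective (β := ι → Φ) (fun g i => ⟨g.1 (α i), hWΦ g.1 g.2 (hmem i)⟩) ?_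
    intro g h hgh
    refine Subtype.ext (LinearEquiv.ext fun x => ?_)
    have h1 : ∀ i, (g : M ≃ₗ[ℤ] M) (α i) = (h : M ≃ₗ[ℤ] M) (α i) := fun i =>
      congrArg Subtype.val (congrFun hgh i)
    apply b.repr.injective
    ext k
    have h2 := hspan (b.coord k ∘ₗ
      ((g : M ≃ₗ[ℤ] M).toLinearMap - (h : M ≃ₗ[ℤ] M).toLinearMap)) fun i => by simp [h1]
    have h3 := LinearMap.congr_fun h2 x
    simpa [sub_eq_zero] using h3
  refine lt_of_le_of_ne ?_ (det_pairing_ne_zero α hα f (fun i => (hf i).1) W rfl hfin).symm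
  rw [← det_one_sub_prod_preReflection b α f Finset.univ.toList (Finset.nodup_toList _) (by simp)]
  let w : M ≃ₗ[ℤ] M := (Finset.univ.toList.map fun i => Module.reflection (hf i).1).prod
  have hwW : w ∈ W := Subgroup.list_prod_mem _ fun g hg => by
    obtain ⟨i, -, rfl⟩ := List.mem_map.mp hg
    exact Subgroup.subset_closure ⟨i, rfl⟩
  have hw : (Finset.univ.toList.map fun i => preReflection (α i) (f i)).prod =
      LinearEquiv.automorphismGroup.toLinearMapMonoidHom w := by
    rw [map_list_prod, List.map_map]
    rfl
  rw [hw]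
  refine linearMap_det_one_sub_nonneg_of_pow_eq_one b _ (m := Nat.card W) Nat.card_pos.ne' ?_
  have h4 : w ^ Nat.card W = 1 :=
    congrArg Subtype.val (pow_card_eq_one' (x := (⟨w, hwW⟩ : W)))
  rw [← map_pow, h4, map_one]

/-- Coroots are unique on the roots. -/
theorem coroot_apply_eq {M : Type*} [AddCommGroup M] [IsTorsionFree ℤ M] {Φ : Set M}
    (hΦ : Φ.Finite) {α β : M} (hα : α ∈ Φ) (hβ : β ∈ Φ) {f : Dual ℤ M} (hf : IsCoroot Φ α f) :
    coroot Φ α β = f β := by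
  have h : IsCoroot Φ α (coroot Φ α) := by
    have hex : ∃ f, IsCoroot Φ α f := ⟨f, hf⟩
    rw [coroot, dif_pos hex]
    exact hex.choose_spec
  have h1 := Dual.eq_of_preReflection_mapsTo' hΦ (Submodule.subset_span hα) h.1 h.2 hf.1 hf.2
  exact LinearMap.congr_fun h1 ⟨β, Submodule.subset_span hβ⟩

end Cartan

section Fixed

open Module

variable {K : Type*} [Field K] {n : ℕ} {G T : Subgroup (GL (Fin n) K)}

/-- If each `s i` acts on the characters by a reflection, a product of the `s i` acts by the product
of the reflections in the same order, since the action `χ ↦ χ ∘ w⁻¹` is a left action. -/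
theorem charEval_weylAut_prod (hT : IsTorus T) {ι : Type*} (α : ι → CharLattice T)
    (f : ι → Dual ℤ (CharLattice T)) (s : ι → WeylGroup G T)
    (hs : ∀ i χ t, charEval χ ((weylAut G hT (s i))⁻¹ t) =
      charEval (preReflection (α i) (f i) χ) t) (l : List ι) (χ : CharLattice T) (t : T) :
    charEval χ ((weylAut G hT (l.map s).prod)⁻¹ t) =
      charEval ((l.map fun i => preReflection (α i) (f i)).prod χ) t := by
  induction l generalizing t with
  | nil => simp
  | cons i l ih =>
    rw [List.map_cons, List.prod_cons, List.map_cons, List.prod_cons, map_mul,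
      _root_.mul_inv_rev, MulAut.mul_apply, ih, hs, Module.End.mul_apply]

/-- If `w` acts on the characters by `u`, its fixed points are the homomorphisms from the character
lattice to `Kˣ` that kill the image of `1 - u`. -/
theorem nonempty_fixedPts_equiv [Infinite K] (hT : IsTorus T) (w : WeylGroup G T)
    (u : End ℤ (CharLattice T))
    (hu : ∀ χ t, charEval χ ((weylAut G hT w)⁻¹ t) = charEval (u χ) t) :
    Nonempty (fixedPts G hT w ≃
      {φ : CharLattice T →ₗ[ℤ] Additive Kˣ // ∀ χ, φ ((1 - u) χ) = 0}) := by
  let E := Equiv.ofBijective _ hT.bijective_evalHom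
  refine ⟨E.subtypeEquiv fun t => ?_⟩
  have h1 : t ∈ fixedPts G hT w ↔ (weylAut G hT w)⁻¹ t = t := by
    rw [MulAut.inv_apply, MulEquiv.symm_apply_eq, eq_comm]
    exact Iff.rfl
  rw [h1, ← E.injective.eq_iff, LinearMap.ext_iff]
  refine forall_congr' fun χ => ?_
  rw [LinearMap.sub_apply, Module.End.one_apply, map_sub, sub_eq_zero, eq_comm]
  change Additive.ofMul (charEval χ t) = Additive.ofMul (charEval χ ((weylAut G hT w)⁻¹ t)) ↔ _
  rw [hu]
  rfl

end Fixed

end AlgGrp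

theorem mainTheorem6 {K : Type*} [Field K] [IsAlgClosed K] {n : ℕ}
    (G T : Subgroup (GL (Fin n) K)) (hG : AlgGrp.IsConnectedSemisimple G)
    (hT : AlgGrp.IsMaximalTorus T G)
    {ι : Type*} [Fintype ι] [DecidableEq ι] (α : ι → AlgGrp.CharLattice T)
    (hα : AlgGrp.IsBase (AlgGrp.roots G T) α)
    (w : AlgGrp.WeylGroup G T) (hw : AlgGrp.IsCoxeterElement G hT.torus α w) :
    (AlgGrp.fixedPts G hT.torus w).Finite ∧
    0 < (AlgGrp.cartanMatrix (AlgGrp.roots G T) α).det ∧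
    (CharZero K → ((AlgGrp.fixedPts G hT.torus w).ncard : ℤ) =
      (AlgGrp.cartanMatrix (AlgGrp.roots G T) α).det) ∧
    (∀ p : ℕ, p.Prime → CharP K p → (AlgGrp.fixedPts G hT.torus w).ncard =
      ordCompl[p] ((AlgGrp.cartanMatrix (AlgGrp.roots G T) α).det.toNat)) := by
  classical
  have : Infinite K := IsAlgClosed.instInfinite
  obtain ⟨s, hs, l, hl, hall, rfl⟩ := hw
  choose f hf hact using hs
  obtain ⟨⟨r, b, -⟩, -⟩ := hT.torus.exists_basis
  have := Module.Free.of_basis b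
  have := Module.Finite.of_basis b
  -- the simple roots span a subgroup of finite index
  have hspan : ∀ g : Module.Dual ℤ (AlgGrp.CharLattice T), (∀ i, g (α i) = 0) → g = 0 := by
    intro g hg
    refine AlgGrp.dual_eq_zero_of_roots hG hT.torus hT.le g fun β hβ => ?_
    have hcl : AddSubmonoid.closure (Set.range α) ≤ AddMonoidHom.mker g.toAddMonoidHom := by
      rw [AddSubmonoid.closure_le]
      rintro _ ⟨i, rfl⟩
      exact hg i
    rcases hα.mem_or_neg_mem β hβ with h | h
    · exact hcl h
    · have h1 : g (-β) = 0 := hcl h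
      rwa [map_neg, neg_eq_zero] at h1
  -- the functionals on the lattice embed in `ι → ℤ` by their values on the simple roots
  have hcard : r = Fintype.card ι := by
    have h1 := hα.linearIndependent.fintype_card_le_finrank
    rw [Module.finrank_eq_card_basis b, Fintype.card_fin] at h1
    refine le_antisymm ?_ h1
    have h2 := LinearMap.finrank_le_finrank_of_injective (R := ℤ)
      (f := (LinearMap.pi fun i => Module.Dual.eval ℤ (AlgGrp.CharLattice T) (α i) :
        Module.Dual ℤ (AlgGrp.CharLattice T) →ₗ[ℤ] ι → ℤ))
      ((injective_iff_map_eq_zero _).mpr fun g hg => hspan g fun i => congrFun hg i)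
    rw [Module.finrank_eq_card_basis b.dualBasis, Fintype.card_fin,
      Module.finrank_fintype_fun_eq_card] at h2
    exact h2
  let b' : Module.Basis ι ℤ (AlgGrp.CharLattice T) :=
    b.reindex ((finCongr hcard).trans (Fintype.equivFin ι).symm)
  have hfin := AlgGrp.finite_roots (G := G) hT.torus
  have hC : AlgGrp.cartanMatrix (AlgGrp.roots G T) α = Matrix.of fun i j => f j (α i) := by
    ext i j
    exact AlgGrp.coroot_apply_eq hfin (hα.mem j) (hα.mem i) (hf j)
  have hpos := AlgGrp.det_pairing_pos b' hfin α hα.mem hα.linearIndependent hspan f hf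
  have hdet := AlgGrp.det_one_sub_prod_preReflection b' α f l hl hall
  rw [hC]
  rw [← hdet] at hpos ⊢
  obtain ⟨E⟩ := AlgGrp.nonempty_fixedPts_equiv hT.torus (l.map s).prod
    (l.map fun i => Module.preReflection (α i) (f i)).prod
    (AlgGrp.charEval_weylAut_prod hT.torus α f s hact l)
  refine ⟨?_, hpos, fun _ => ?_, fun p hp _ => ?_⟩
  · have := AlgGrp.finite_homs_killing_range (K := K) b' _ hpos.ne'
    exact Finite.of_equiv _ E.symm
  · rw [← Nat.card_coe_set_eq, Nat.card_congr E,
      AlgGrp.card_homs_killing_range_of_charZero b' _ hpos.ne', Int.natAbs_of_nonneg hpos.le]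
  · rw [← Nat.card_coe_set_eq, Nat.card_congr E,
      AlgGrp.card_homs_killing_range_of_charP hp b' _ hpos.ne',
      show ∀ d : ℤ, 0 < d → d.natAbs = d.toNat by omega]
    exact hpos
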